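/- Let $(M,g)$ and $(N,h)$ be smooth Riemannian manifolds, let $\varphi:M\to N$ be a smooth map and let $V$ be a smooth vector field on $M$. Let $\nabla$ and $\nabla^N$ be the Levi-Civita connections of $g$ and $h$, with curvature tensor $R(X,Y)Z=\nabla_X\nabla_YZ-\nabla_Y\nabla_XZ-\nabla_{[X,Y]}Z$ (and $R^N$ likewise on $N$), and let $\nabla^\varphi$ be the connection on the pull-back bundle $\varphi^{-1}TN$ induced by $\nabla^N$. With $\{e_i\}$ a local orthonormal frame on $M$, put, for a smooth section $v$ of $\varphi^{-1}TN$, $$\operatorname{tr}(\nabla^\varphi)^2v=\sum_i\Big(\nabla^\varphi_{e_i}\nabla^\varphi_{e_i}v-\nabla^\varphi_{\nabla_{e_i}e_i}v\Big),\qquad \operatorname{Ric}^\varphi v=\sum_iR^N(v,d\varphi(e_i))\,d\varphi(e_i),$$ and let $\operatorname{tr}\nabla^2V=\sum_i(\nabla_{e_i}\nabla_{e_i}V-\nabla_{\nabla_{e_i}e_i}V)$ and $\operatorname{Ric}V=\sum_iR(V,e_i)e_i$ be the corresponding operators on $TM$. Let $\nabla d\varphi(X,Y)=\nabla^\varphi_X(d\varphi(Y))-d\varphi(\nabla_XY)$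 be the second fundamental form of $\varphi$ and $\tau(\varphi)=\operatorname{tr}\nabla d\varphi=\sum_i\nabla d\varphi(e_i,e_i)$ its tension field. Then, at every point of $M$, $$\big(\operatorname{tr}(\nabla^\varphi)^2+\operatorname{Ric}^\varphi\big)\big(d\varphi(V)\big)=d\varphi\big((\operatorname{tr}\nabla^2+\operatorname{Ric})(V)\big)+\nabla^\varphi_V\tau(\varphi)+2\sum_i\nabla d\varphi(e_i,\nabla_{e_i}V).$$ -/

import Mathlib

open Bundle Manifold ContDiff FiberBundle

noncomputable section

namespace RiemMap

/-! ### Coordinate connections -/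

section Connection

variable {E : Type*} [NormedAddCommGroup E] [NormedSpace ℝ E]
  {M : Type*} [TopologicalSpace M] [ChartedSpace E M]
  {F : Type*} [NormedAddCommGroup F] [NormedSpace ℝ F]

theorem mvfderiv_congr {f g : M → F} {x : M} (h : f =ᶠ[nhds x] g) :
    mvfderiv 𝓘(ℝ, E) f x = mvfderiv 𝓘(ℝ, E) g x := by
  ext v
  simp only [mvfderiv, h.mfderiv_eq]
  rfl

variable (V : M → Type*) [TopologicalSpace (TotalSpace F V)]
  [∀ x, AddCommGroup (V x)] [∀ x, Module ℝ (V x)] [∀ x, TopologicalSpace (V x)]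
  [∀ x, IsTopologicalAddGroup (V x)] [∀ x, ContinuousSMul ℝ (V x)]
  [FiberBundle F V] [VectorBundle ℝ F V]

/-- An auxiliary (non-canonical) connection on a vector bundle: at the point `x`, differentiate the
components of the section in the preferred local trivialization at `x`. -/
def trivConn : CovariantDerivative 𝓘(ℝ, E) F V where
  toFun σ x := ((trivializationAt F V x).symmL ℝ x) ∘L
    mvfderiv 𝓘(ℝ, E) (fun y ↦ (trivializationAt F V x ⟨y, σ y⟩).2) x
  isCovariantDerivativeOnUniv :=
    { add := by
        intro σ σ' x hσ hσ' _
        have h1 := (mdifferentiableAt_section _ _).1 hσ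
        have h2 := (mdifferentiableAt_section _ _).1 hσ'
        have h3 : (fun y ↦ (trivializationAt F V x ⟨y, (σ + σ') y⟩).2) =ᶠ[nhds x]
            (fun y ↦ (trivializationAt F V x ⟨y, σ y⟩).2) +
              (fun y ↦ (trivializationAt F V x ⟨y, σ' y⟩).2) := by
          filter_upwards [(trivializationAt F V x).open_baseSet.mem_nhds
            (mem_baseSet_trivializationAt F V x)] with y hy
          exact ((trivializationAt F V x).linear ℝ hy).map_add _ _
        rw [mvfderiv_congr h3, mvfderiv_add h1 h2, ContinuousLinearMap.comp_add]
      leibniz := by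
        intro σ g x hσ hg _
        have h1 := (mdifferentiableAt_section _ _).1 hσ
        have h3 : (fun y ↦ (trivializationAt F V x ⟨y, (g • σ) y⟩).2) =ᶠ[nhds x]
            g • (fun y ↦ (trivializationAt F V x ⟨y, σ y⟩).2) := by
          filter_upwards [(trivializationAt F V x).open_baseSet.mem_nhds
            (mem_baseSet_trivializationAt F V x)] with y hy
          exact ((trivializationAt F V x).linear ℝ hy).map_smul _ _
        rw [mvfderiv_congr h3, mvfderiv_smul hg h1]
        ext v
        simp [mem_baseSet_trivializationAt F V x] }

end Connection

/-! ### The Levi-Civita connection -/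

section LeviCivita

variable {E : Type*} [NormedAddCommGroup E] [NormedSpace ℝ E]
  {M : Type*} [TopologicalSpace M] [ChartedSpace E M] [IsManifold 𝓘(ℝ, E) ∞ M]
  (g : ContMDiffRiemannianMetric 𝓘(ℝ, E) ∞ E (fun x : M ↦ TangentSpace 𝓘(ℝ, E) x))

theorem mdifferentiableAt_metric {σ τ : Π x : M, TangentSpace 𝓘(ℝ, E) x} {x : M}
    (hσ : MDiffAt (T% σ) x) (hτ : MDiffAt (T% τ) x) :
    MDiffAt (fun y ↦ g.inner y (σ y) (τ y)) x := by
  have : MDifferentiableAt 𝓘(ℝ, E) (𝓘(ℝ, E).prod 𝓘(ℝ))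
      (fun m ↦ TotalSpace.mk' ℝ (E := Bundle.Trivial M ℝ) m (g.inner m (σ m) (τ m))) x := by
    apply MDifferentiableAt.clm_bundle_apply₂ (F₁ := E) (F₂ := E)
    · exact g.contMDiff.mdifferentiableAt (by simp)
    · exact hσ
    · exact hτ
  simp only [mdifferentiableAt_totalSpace] at this
  exact this.2

theorem extend_add_vec {x : M} (v w : TangentSpace 𝓘(ℝ, E) x) :
    ∀ᶠ y in nhds x, extend E (v + w) y = extend E v y + extend E w y := by
  filter_upwards [(trivializationAt E (TangentSpace 𝓘(ℝ, E)) x).open_baseSet.mem_nhds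
    (mem_baseSet_trivializationAt E (TangentSpace 𝓘(ℝ, E)) x)] with y hy
  simp only [extend]
  rw [((trivializationAt E (TangentSpace 𝓘(ℝ, E)) x).linear ℝ
    (mem_baseSet_trivializationAt E (TangentSpace 𝓘(ℝ, E)) x)).map_add]
  simp only [← Trivialization.symmₗ_apply (R := ℝ) _ hy, map_add]

theorem extend_smul_vec {x : M} (c : ℝ) (v : TangentSpace 𝓘(ℝ, E) x) :
    ∀ᶠ y in nhds x, extend E (c • v) y = c • extend E v y := by
  filter_upwards [(trivializationAt E (TangentSpace 𝓘(ℝ, E)) x).open_baseSet.mem_nhds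
    (mem_baseSet_trivializationAt E (TangentSpace 𝓘(ℝ, E)) x)] with y hy
  simp only [extend]
  rw [((trivializationAt E (TangentSpace 𝓘(ℝ, E)) x).linear ℝ
    (mem_baseSet_trivializationAt E (TangentSpace 𝓘(ℝ, E)) x)).map_smul]
  simp only [← Trivialization.symmₗ_apply (R := ℝ) _ hy, map_smul]

/-- The coordinate derivative `(∂_a g)(b, c)` at `x`, where `b` and `c` are extended with constant
components in the preferred chart at `x`. -/
def metricDeriv (x : M) (a b c : TangentSpace 𝓘(ℝ, E) x) : ℝ :=
  mvfderiv 𝓘(ℝ, E) (fun y ↦ g.inner y (extend E b y) (extend E c y)) x a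

theorem metricDeriv_symm (x : M) (a b c : TangentSpace 𝓘(ℝ, E) x) :
    metricDeriv g x a b c = metricDeriv g x a c b := by
  unfold metricDeriv
  simp only [g.symm]

theorem metricDeriv_add_left (x : M) (a a' b c : TangentSpace 𝓘(ℝ, E) x) :
    metricDeriv g x (a + a') b c = metricDeriv g x a b c + metricDeriv g x a' b c := by
  simp [metricDeriv]

theorem metricDeriv_smul_left (x : M) (r : ℝ) (a b c : TangentSpace 𝓘(ℝ, E) x) :
    metricDeriv g x (r • a) b c = r * metricDeriv g x a b c := by
  simp [metricDeriv]

theorem metricDeriv_add_mid (x : M) (a b b' c : TangentSpace 𝓘(ℝ, E) x) :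
    metricDeriv g x a (b + b') c = metricDeriv g x a b c + metricDeriv g x a b' c := by
  have h := mvfderiv_add
    (mdifferentiableAt_metric g (mdifferentiableAt_extend 𝓘(ℝ, E) E b)
      (mdifferentiableAt_extend 𝓘(ℝ, E) E c))
    (mdifferentiableAt_metric g (mdifferentiableAt_extend 𝓘(ℝ, E) E b')
      (mdifferentiableAt_extend 𝓘(ℝ, E) E c))
  have h' := congrArg (fun L ↦ L a) h
  refine Eq.trans ?_ h'
  refine congrArg (fun L : TangentSpace 𝓘(ℝ, E) x →L[ℝ] ℝ ↦ L a)
      (mvfderiv_congr (E := E) (F := ℝ) (x := x) ?_)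
  filter_upwards [extend_add_vec b b'] with y hy
  simp [hy]

theorem metricDeriv_smul_mid (x : M) (r : ℝ) (a b c : TangentSpace 𝓘(ℝ, E) x) :
    metricDeriv g x a (r • b) c = r * metricDeriv g x a b c := by
  have h := mvfderiv_smul (a := fun _ : M ↦ r) mdifferentiableAt_const
    (mdifferentiableAt_metric g (mdifferentiableAt_extend 𝓘(ℝ, E) E b)
      (mdifferentiableAt_extend 𝓘(ℝ, E) E c))
  have h' := congrArg (fun L ↦ L a) h
  simp only [mvfderiv_const] at h'
  refine Eq.trans ?_ (h'.trans ?_)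
  · refine congrArg (fun L : TangentSpace 𝓘(ℝ, E) x →L[ℝ] ℝ ↦ L a)
      (mvfderiv_congr (E := E) (F := ℝ) (x := x) ?_)
    filter_upwards [extend_smul_vec r b] with y hy
    simp [hy]
  · simp [metricDeriv]

theorem metricDeriv_add_right (x : M) (a b c c' : TangentSpace 𝓘(ℝ, E) x) :
    metricDeriv g x a b (c + c') = metricDeriv g x a b c + metricDeriv g x a b c' := by
  rw [metricDeriv_symm, metricDeriv_add_mid, metricDeriv_symm g x a c, metricDeriv_symm g x a c']

theorem metricDeriv_smul_right (x : M) (r : ℝ) (a b c : TangentSpace 𝓘(ℝ, E) x) :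
    metricDeriv g x a b (r • c) = r * metricDeriv g x a b c := by
  rw [metricDeriv_symm, metricDeriv_smul_mid, metricDeriv_symm g x a c]

theorem trivConn_extend (x : M) (b : TangentSpace 𝓘(ℝ, E) x) :
    trivConn (E := E) (F := E) (fun x : M ↦ TangentSpace 𝓘(ℝ, E) x) (extend E b) x = 0 := by
  have h3 : (fun y ↦ (trivializationAt E (TangentSpace 𝓘(ℝ, E)) x ⟨y, extend E b y⟩).2) =ᶠ[nhds x]
      fun _ ↦ (trivializationAt E (TangentSpace 𝓘(ℝ, E)) x ⟨x, b⟩).2 := by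
    filter_upwards [(trivializationAt E (TangentSpace 𝓘(ℝ, E)) x).open_baseSet.mem_nhds
      (mem_baseSet_trivializationAt E (TangentSpace 𝓘(ℝ, E)) x)] with y hy
    change (trivializationAt E (TangentSpace 𝓘(ℝ, E)) x ⟨y,
      (trivializationAt E (TangentSpace 𝓘(ℝ, E)) x).symm y _⟩).2 = _
    rw [Trivialization.apply_mk_symm _ hy]
  change _ ∘L mvfderiv 𝓘(ℝ, E) _ x = 0
  rw [mvfderiv_congr h3, mvfderiv_const, ContinuousLinearMap.comp_zero]

theorem lieBracketWithin_of_const {P Q : E → E} {p q z : E} (hP : P =ᶠ[nhds z] fun _ ↦ p)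
    (hQ : Q =ᶠ[nhds z] fun _ ↦ q) : VectorField.lieBracketWithin ℝ P Q Set.univ z = 0 := by
  rw [VectorField.lieBracketWithin_univ, VectorField.lieBracket_eq]
  simp [hP.fderiv_eq, hQ.fderiv_eq]

variable [FiniteDimensional ℝ E]

instance tangentSpace_finiteDimensional (x : M) : FiniteDimensional ℝ (TangentSpace 𝓘(ℝ, E) x) :=
  inferInstanceAs (FiniteDimensional ℝ E)

instance tangentSpace_t2Space (x : M) : T2Space (TangentSpace 𝓘(ℝ, E) x) :=
  inferInstanceAs (T2Space E)

theorem exists_orthonormal_basis (x : M) :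
    ∃ e : Module.Basis (Fin (Module.finrank ℝ E)) ℝ (TangentSpace 𝓘(ℝ, E) x),
      ∀ i j, g.inner x (e i) (e j) = if i = j then 1 else 0 := by
  let c := g.toRiemannianMetric.toCore x
  let : NormedAddCommGroup (TangentSpace 𝓘(ℝ, E) x) := c.toNormedAddCommGroup
  let : InnerProductSpace ℝ (TangentSpace 𝓘(ℝ, E) x) := InnerProductSpace.ofCore c.toCore
  refine ⟨(stdOrthonormalBasis ℝ (TangentSpace 𝓘(ℝ, E) x)).toBasis, fun i j ↦ ?_⟩
  have := orthonormal_iff_ite.1 (stdOrthonormalBasis ℝ (TangentSpace 𝓘(ℝ, E) x)).orthonormal i j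
  rwa [← OrthonormalBasis.coe_toBasis] at this

/-- A basis of the tangent space at `x` that is orthonormal for the metric `g`. -/
def onb (x : M) : Module.Basis (Fin (Module.finrank ℝ E)) ℝ (TangentSpace 𝓘(ℝ, E) x) :=
  (exists_orthonormal_basis g x).choose

theorem onb_orthonormal (x : M) (i j : Fin (Module.finrank ℝ E)) :
    g.inner x (onb g x i) (onb g x j) = if i = j then 1 else 0 :=
  (exists_orthonormal_basis g x).choose_spec i j

/-- The Christoffel symbols at `x`, in the preferred chart at `x`: `Γ(b, a)` is the vector with
`g(Γ(b, a), c) = ((∂_a g)(b, c) + (∂_b g)(a, c) - (∂_c g)(a, b)) / 2` for all `c`. -/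
def christoffel (x : M) : TangentSpace 𝓘(ℝ, E) x →L[ℝ] TangentSpace 𝓘(ℝ, E) x →L[ℝ]
    TangentSpace 𝓘(ℝ, E) x :=
  LinearMap.toContinuousBilinearMap (LinearMap.mk₂ ℝ
    (fun b a ↦ ∑ i, ((1 / 2 : ℝ) * (metricDeriv g x a b (onb g x i)
      + metricDeriv g x b a (onb g x i) - metricDeriv g x (onb g x i) a b)) • onb g x i)
    (fun b b' a ↦ by
      rw [← Finset.sum_add_distrib]
      refine Finset.sum_congr rfl fun i _ ↦ ?_
      rw [metricDeriv_add_mid, metricDeriv_add_left, metricDeriv_add_right, ← add_smul]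
      congr 1
      ring)
    (fun r b a ↦ by
      rw [Finset.smul_sum]
      refine Finset.sum_congr rfl fun i _ ↦ ?_
      rw [metricDeriv_smul_mid, metricDeriv_smul_left, metricDeriv_smul_right, smul_smul]
      congr 1
      ring)
    (fun b a a' ↦ by
      rw [← Finset.sum_add_distrib]
      refine Finset.sum_congr rfl fun i _ ↦ ?_
      rw [metricDeriv_add_left, metricDeriv_add_mid, metricDeriv_add_mid, ← add_smul]
      congr 1
      ring)
    (fun r b a ↦ by
      rw [Finset.smul_sum]
      refine Finset.sum_congr rfl fun i _ ↦ ?_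
      rw [metricDeriv_smul_left, metricDeriv_smul_mid, metricDeriv_smul_mid, smul_smul]
      congr 1
      ring))

/-- The Levi-Civita connection of `g`: `(∇_a Y)(x) = ∂_a Y + Γ(Y(x), a)` in the preferred chart
at `x`. -/
def leviCivita : CovariantDerivative 𝓘(ℝ, E) E (fun x : M ↦ TangentSpace 𝓘(ℝ, E) x) :=
  (trivConn (fun x : M ↦ TangentSpace 𝓘(ℝ, E) x)).addOneForm (christoffel g)

theorem christoffel_apply (x : M) (b a : TangentSpace 𝓘(ℝ, E) x) :
    christoffel g x b a = ∑ i, ((1 / 2 : ℝ) * (metricDeriv g x a b (onb g x i)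
      + metricDeriv g x b a (onb g x i) - metricDeriv g x (onb g x i) a b)) • onb g x i := rfl

theorem inner_christoffel (x : M) (b a c : TangentSpace 𝓘(ℝ, E) x) :
    g.inner x (christoffel g x b a) c = (1 / 2 : ℝ) * (metricDeriv g x a b c
      + metricDeriv g x b a c - metricDeriv g x c a b) := by
  let R : TangentSpace 𝓘(ℝ, E) x →ₗ[ℝ] ℝ :=
    { toFun := fun c ↦ (1 / 2 : ℝ) * (metricDeriv g x a b c
        + metricDeriv g x b a c - metricDeriv g x c a b)
      map_add' := fun c c' ↦ by
        rw [metricDeriv_add_right, metricDeriv_add_right, metricDeriv_add_left]; ring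
      map_smul' := fun r c ↦ by
        rw [metricDeriv_smul_right, metricDeriv_smul_right, metricDeriv_smul_left]
        simp only [RingHom.id_apply, smul_eq_mul]; ring }
  have h : (g.inner x (christoffel g x b a)).toLinearMap = R := by
    refine (onb g x).ext fun j ↦ ?_
    simp [christoffel_apply, onb_orthonormal, R]
  exact congrArg (fun L ↦ L c) h

/-- The Levi-Civita connection is compatible with the metric. -/
theorem leviCivita_metric {σ τ : Π x : M, TangentSpace 𝓘(ℝ, E) x} {x : M}
    (hσ : MDiffAt (T% σ) x) (hτ : MDiffAt (T% τ) x) (a : TangentSpace 𝓘(ℝ, E) x) :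
    mvfderiv 𝓘(ℝ, E) (fun y ↦ g.inner y (σ y) (τ y)) x a =
      g.inner x (leviCivita g σ x a) (τ x) + g.inner x (σ x) (leviCivita g τ x a) := by
  let D := trivConn (E := E) (F := E) (fun x : M ↦ TangentSpace 𝓘(ℝ, E) x)
  let Φ (σ τ : Π x : M, TangentSpace 𝓘(ℝ, E) x) : ℝ :=
    mvfderiv 𝓘(ℝ, E) (fun y ↦ g.inner y (σ y) (τ y)) x a
      - g.inner x (D σ x a) (τ x) - g.inner x (σ x) (D τ x a)
  have hsymm (σ τ) : Φ σ τ = Φ τ σ := by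
    simp only [Φ, g.symm _ (D σ x a), g.symm _ (σ x) (D τ x a), g.symm _ (σ _) (τ _)]
    ring
  have h1 (τ : Π x : M, TangentSpace 𝓘(ℝ, E) x) (hτ : MDiffAt (T% τ) x) :
      TensorialAt 𝓘(ℝ, E) E (Φ · τ) x :=
    { smul := fun {f σ} hf hσ ↦ by
        have e1 : (fun y ↦ g.inner y ((f • σ) y) (τ y)) =
            f • (fun y ↦ g.inner y (σ y) (τ y)) := by
          funext y; simp
        have e2 := D.isCovariantDerivativeOnUniv.leibniz hσ hf
        simp only [Φ]
        rw [e1, mvfderiv_smul hf (mdifferentiableAt_metric g hσ hτ), e2]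
        simp
        ring
      add := fun {σ σ'} hσ hσ' ↦ by
        have e1 : (fun y ↦ g.inner y ((σ + σ') y) (τ y)) =
            (fun y ↦ g.inner y (σ y) (τ y)) + (fun y ↦ g.inner y (σ' y) (τ y)) := by
          funext y; simp
        have e2 := D.isCovariantDerivativeOnUniv.add hσ hσ'
        simp only [Φ]
        rw [e1, mvfderiv_add (mdifferentiableAt_metric g hσ hτ) (mdifferentiableAt_metric g hσ' hτ),
          e2]
        simp
        ring }
  have h2 (σ : Π x : M, TangentSpace 𝓘(ℝ, E) x) (hσ : MDiffAt (T% σ) x) :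
      TensorialAt 𝓘(ℝ, E) E (Φ σ ·) x := by
    simpa only [hsymm σ] using h1 σ hσ
  have key : Φ σ τ = metricDeriv g x a (σ x) (τ x) := by
    rw [TensorialAt.pointwise₂ h1 h2 hσ (mdifferentiableAt_extend 𝓘(ℝ, E) E (σ x)) hτ
      (mdifferentiableAt_extend 𝓘(ℝ, E) E (τ x)) (by simp) (by simp)]
    simp [Φ, D, trivConn_extend, metricDeriv]
  have e (σ : Π x : M, TangentSpace 𝓘(ℝ, E) x) :
      leviCivita g σ x a = D σ x a + christoffel g x (σ x) a := rfl
  rw [e, e, map_add, map_add, add_apply, inner_christoffel,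
    g.symm x (σ x) (christoffel g x (τ x) a), inner_christoffel]
  have s1 := metricDeriv_symm g x a (σ x) (τ x)
  have s2 := metricDeriv_symm g x (σ x) a (τ x)
  have s3 := metricDeriv_symm g x (τ x) a (σ x)
  simp only [Φ] at key
  linarith

theorem mlieBracket_extend (x : M) (b c : TangentSpace 𝓘(ℝ, E) x) :
    VectorField.mlieBracket 𝓘(ℝ, E) (extend E b) (extend E c) x = 0 := by
  have hc (b : TangentSpace 𝓘(ℝ, E) x) :
      VectorField.mpullbackWithin 𝓘(ℝ, E) 𝓘(ℝ, E) (extChartAt 𝓘(ℝ, E) x).symm (extend E b)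
        (Set.range 𝓘(ℝ, E)) =ᶠ[nhds (extChartAt 𝓘(ℝ, E) x x)]
        fun _ ↦ (trivializationAt E (TangentSpace 𝓘(ℝ, E)) x ⟨x, b⟩).2 := by
    filter_upwards [extChartAt_target_mem_nhds (I := 𝓘(ℝ, E)) x] with u hu
    have hy : (extChartAt 𝓘(ℝ, E) x).symm u ∈ (chartAt E x).source := by
      simpa using (extChartAt 𝓘(ℝ, E) x).map_target hu
    have h := TangentBundle.symmL_trivializationAt (I := 𝓘(ℝ, E)) hy
    rw [(extChartAt 𝓘(ℝ, E) x).right_inv hu] at h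
    have hb : (extChartAt 𝓘(ℝ, E) x).symm u ∈
        (trivializationAt E (TangentSpace 𝓘(ℝ, E)) x).baseSet := hy
    have h2 : extend E b ((extChartAt 𝓘(ℝ, E) x).symm u) =
        (mfderivWithin 𝓘(ℝ, E) 𝓘(ℝ, E) (extChartAt 𝓘(ℝ, E) x).symm (Set.range 𝓘(ℝ, E)) u)
          (trivializationAt E (TangentSpace 𝓘(ℝ, E)) x ⟨x, b⟩).2 := by
      rw [← h]
      exact (Trivialization.symmL_apply (R := ℝ) _ hb _).symm
    rw [VectorField.mpullbackWithin_apply, h2]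
    exact (isInvertible_mfderivWithin_extChartAt_symm hu).inverse_apply_self _
  rw [← VectorField.mlieBracketWithin_univ, VectorField.mlieBracketWithin_apply]
  have h0 : VectorField.lieBracketWithin ℝ
      (VectorField.mpullbackWithin 𝓘(ℝ, E) 𝓘(ℝ, E) (extChartAt 𝓘(ℝ, E) x).symm (extend E b)
        (Set.range 𝓘(ℝ, E)))
      (VectorField.mpullbackWithin 𝓘(ℝ, E) 𝓘(ℝ, E) (extChartAt 𝓘(ℝ, E) x).symm (extend E c)
        (Set.range 𝓘(ℝ, E)))
      ((extChartAt 𝓘(ℝ, E) x).symm ⁻¹' Set.univ ∩ Set.range 𝓘(ℝ, E))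
      (extChartAt 𝓘(ℝ, E) x x) = 0 := by
    rw [show (extChartAt 𝓘(ℝ, E) x).symm ⁻¹' Set.univ ∩ Set.range 𝓘(ℝ, E) = Set.univ by simp]
    exact lieBracketWithin_of_const (hc b) (hc c)
  rw [h0]
  exact map_zero (mfderiv 𝓘(ℝ, E) 𝓘(ℝ, E) (extChartAt 𝓘(ℝ, E) x) x).inverse

/-- The Levi-Civita connection is torsion-free. -/
theorem leviCivita_torsion : (leviCivita g).torsion = 0 := by
  funext x
  ext b c
  rw [CovariantDerivative.torsion_apply_eq_extend, mlieBracket_extend]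
  have e (σ : Π x : M, TangentSpace 𝓘(ℝ, E) x) (a : TangentSpace 𝓘(ℝ, E) x) :
      leviCivita g σ x a = trivConn (E := E) (F := E) (fun x : M ↦ TangentSpace 𝓘(ℝ, E) x) σ x a
        + christoffel g x (σ x) a := rfl
  have s : christoffel g x b c = christoffel g x c b := by
    simp only [christoffel_apply]
    refine Finset.sum_congr rfl fun i _ ↦ ?_
    rw [metricDeriv_symm g x (onb g x i), add_comm (metricDeriv g x c b _)]
  rw [e, e, trivConn_extend, trivConn_extend]
  simp [s]

end LeviCivita

/-! ### Operators along a smooth map -/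

section Pullback

variable {M N : Type*} {T : N → Type*} (f : M → N)

instance pullback_addCommGroup [∀ y, AddCommGroup (T y)] (x : M) :
    AddCommGroup ((f *ᵖ T) x) :=
  inferInstanceAs (AddCommGroup (T (f x)))

instance pullback_isTopologicalAddGroup [∀ y, AddCommGroup (T y)] [∀ y, TopologicalSpace (T y)]
    [∀ y, IsTopologicalAddGroup (T y)] (x : M) : IsTopologicalAddGroup ((f *ᵖ T) x) :=
  inferInstanceAs (IsTopologicalAddGroup (T (f x)))

instance pullback_continuousSMul [∀ y, AddCommGroup (T y)] [∀ y, Module ℝ (T y)]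
    [∀ y, TopologicalSpace (T y)] [∀ y, ContinuousSMul ℝ (T y)] (x : M) :
    ContinuousSMul ℝ ((f *ᵖ T) x) :=
  inferInstanceAs (ContinuousSMul ℝ (T (f x)))

end Pullback

section Maps

variable {E : Type*} [NormedAddCommGroup E] [NormedSpace ℝ E] [FiniteDimensional ℝ E]
  {M : Type*} [TopologicalSpace M] [ChartedSpace E M] [IsManifold 𝓘(ℝ, E) ∞ M]
  (g : ContMDiffRiemannianMetric 𝓘(ℝ, E) ∞ E (fun x : M ↦ TangentSpace 𝓘(ℝ, E) x))
  {F : Type*} [NormedAddCommGroup F] [NormedSpace ℝ F] [FiniteDimensional ℝ F]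
  {N : Type*} [TopologicalSpace N] [ChartedSpace F N] [IsManifold 𝓘(ℝ, F) ∞ N]
  (h : ContMDiffRiemannianMetric 𝓘(ℝ, F) ∞ F (fun y : N ↦ TangentSpace 𝓘(ℝ, F) y))
  (φ : C^∞⟮𝓘(ℝ, E), M; 𝓘(ℝ, F), N⟯)

/-- The pull-back bundle `φ⁻¹TN`, with fiber `T_{φ(x)}N` at `x`. -/
abbrev PullbackTangent (x : M) : Type _ := ((φ : M → N) *ᵖ (fun y : N ↦ TangentSpace 𝓘(ℝ, F) y)) x

/-- The differential of `φ` at `x`, with values in the fiber of `φ⁻¹TN`. -/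
def differential (x : M) : TangentSpace 𝓘(ℝ, E) x →L[ℝ] PullbackTangent φ x :=
  mfderiv 𝓘(ℝ, E) 𝓘(ℝ, F) φ x

/-- The Christoffel term of `h` along `φ`: `(b, a) ↦ Γ(b, dφ(a))`. -/
def christoffelAlong (x : M) :
    PullbackTangent φ x →L[ℝ] TangentSpace 𝓘(ℝ, E) x →L[ℝ] PullbackTangent φ x :=
  letI Γ : TangentSpace 𝓘(ℝ, F) (φ x) →L[ℝ] TangentSpace 𝓘(ℝ, E) x →L[ℝ]
      TangentSpace 𝓘(ℝ, F) (φ x) :=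
    LinearMap.toContinuousBilinearMap (LinearMap.mk₂ ℝ
      (fun b a ↦ christoffel h (φ x) b (mfderiv 𝓘(ℝ, E) 𝓘(ℝ, F) φ x a))
      (by simp) (by simp) (by simp) (by simp))
  Γ

/-- The connection `∇^φ` on the pull-back bundle `φ⁻¹TN` induced by the Levi-Civita connection
of `h`. -/
def pullbackConn : CovariantDerivative 𝓘(ℝ, E) F (PullbackTangent φ) :=
  (trivConn (PullbackTangent φ)).addOneForm
    (christoffelAlong h φ)

/-- The defining property of the pull-back connection: `∇^φ_a (W ∘ φ) = ∇^N_{dφ(a)} W`. -/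
theorem pullbackConn_comp (W : Π y : N, TangentSpace 𝓘(ℝ, F) y) (x : M) (hW : MDiffAt (T% W) (φ x))
    (a : TangentSpace 𝓘(ℝ, E) x) :
    pullbackConn h φ (fun z ↦ W (φ z)) x a =
      leviCivita h W (φ x) (mfderiv 𝓘(ℝ, E) 𝓘(ℝ, F) φ x a) := by
  have hW' := (mdifferentiableAt_section _ _).1 hW
  have h1 : mvfderiv 𝓘(ℝ, E) (fun z ↦ (trivializationAt F (PullbackTangent φ) x ⟨z, W (φ z)⟩).2) x a =
      mvfderiv 𝓘(ℝ, F) (fun y ↦ (trivializationAt F (TangentSpace 𝓘(ℝ, F)) (φ x) ⟨y, W y⟩).2)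
        (φ x) (mfderiv 𝓘(ℝ, E) 𝓘(ℝ, F) φ x a) :=
    mfderiv_comp_apply (I' := 𝓘(ℝ, F)) x hW' (φ.contMDiff.mdifferentiableAt (by simp)) a
  have h2 (b : F) : (trivializationAt F (PullbackTangent φ) x).symmL ℝ x b =
      (trivializationAt F (TangentSpace 𝓘(ℝ, F)) (φ x)).symmL ℝ (φ x) b := by
    have hx := mem_baseSet_trivializationAt F (PullbackTangent φ) x
    have hy := mem_baseSet_trivializationAt F (TangentSpace 𝓘(ℝ, F)) (φ x)
    rw [Trivialization.symmL_apply _ hx, Trivialization.symmL_apply _ hy]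
    have h3 : (trivializationAt F (TangentSpace 𝓘(ℝ, F)) (φ x)
        ⟨φ x, (trivializationAt F (PullbackTangent φ) x).symm x b⟩).2 = b :=
      congrArg Prod.snd (Trivialization.apply_mk_symm (trivializationAt F (PullbackTangent φ) x)
        hx b)
    have h4 := Trivialization.symm_apply_apply_mk (trivializationAt F (TangentSpace 𝓘(ℝ, F)) (φ x))
      hy ((trivializationAt F (PullbackTangent φ) x).symm x b)
    rw [h3] at h4
    exact h4.symm
  change (trivializationAt F (PullbackTangent φ) x).symmL ℝ x
      (mvfderiv 𝓘(ℝ, E) (fun z ↦ (trivializationAt F (PullbackTangent φ) x ⟨z, W (φ z)⟩).2) x a) +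
      christoffelAlong h φ x (W (φ x)) a = _
  rw [h1, h2]
  rfl

/-- The differential of `φ` applied to a vector field, a section of `φ⁻¹TN`. -/
def push (X : Π x : M, TangentSpace 𝓘(ℝ, E) x) :
    Π x : M, PullbackTangent φ x :=
  fun x ↦ differential φ x (X x)

/-- The second fundamental form `∇dφ(a, b) = ∇^φ_a (dφ(B)) - dφ(∇_a B)` at `x`, where `B` is a
local vector field with `B(x) = b` (the value does not depend on the choice of `B`). -/
def secondFundamentalForm (x : M) (a b : TangentSpace 𝓘(ℝ, E) x) :
    PullbackTangent φ x :=
  letI B := extend E b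
  pullbackConn h φ (push φ B) x a
    - differential φ x (leviCivita g B x a)

/-- The tension field `τ(φ) = tr ∇dφ`. -/
def tension : Π x : M, PullbackTangent φ x :=
  fun x ↦ ∑ i, secondFundamentalForm g h φ x (onb g x i) (onb g x i)

/-- The curvature tensor `R(a, b)c = ∇_A ∇_B C - ∇_B ∇_A C - ∇_[A,B] C` at `x`, where `A`, `B`, `C`
are local vector fields with values `a`, `b`, `c` at `x` (the value does not depend on the choice
of these fields). -/
def curvature (x : M) (a b c : TangentSpace 𝓘(ℝ, E) x) : TangentSpace 𝓘(ℝ, E) x :=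
  letI A := extend E a
  letI B := extend E b
  letI C := extend E c
  leviCivita g (fun y ↦ leviCivita g C y (B y)) x a
    - leviCivita g (fun y ↦ leviCivita g C y (A y)) x b
    - leviCivita g C x (VectorField.mlieBracket 𝓘(ℝ, E) A B x)

/-- The Ricci operator `Ric v = ∑ R(v, e_i) e_i` on tangent vectors. -/
def ricci (x : M) (v : TangentSpace 𝓘(ℝ, E) x) : TangentSpace 𝓘(ℝ, E) x :=
  ∑ i, curvature g x v (onb g x i) (onb g x i)

/-- The Ricci operator `Ric^φ v = ∑ R^N(v, dφ(e_i)) dφ(e_i)` along `φ`. -/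
def ricciAlong (x : M) (v : PullbackTangent φ x) : PullbackTangent φ x :=
  ∑ i, curvature h (φ x) v (differential φ x (onb g x i))
    (differential φ x (onb g x i))

/-- The trace `tr D² σ = ∑ (D_{e_i} D_{e_i} σ - D_{∇_{e_i} e_i} σ)` at `x` of the second covariant
derivative of a section `σ` of a vector bundle with connection `D`, where the `e_i` are local vector
fields that form an orthonormal basis at `x` (the value does not depend on their choice). -/
def roughLaplacian {F : Type*} [NormedAddCommGroup F] [NormedSpace ℝ F]
    {V : M → Type*} [TopologicalSpace (TotalSpace F V)]
    [∀ x, AddCommGroup (V x)] [∀ x, Module ℝ (V x)] [∀ x, TopologicalSpace (V x)]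
    [∀ x, IsTopologicalAddGroup (V x)] [∀ x, ContinuousSMul ℝ (V x)] [FiberBundle F V]
    (D : CovariantDerivative 𝓘(ℝ, E) F V) (σ : Π x : M, V x) (x : M) : V x :=
  ∑ i, letI e := extend E (onb g x i)
    (D (fun y ↦ D σ y (e y)) x (e x) - D σ x (leviCivita g e x (e x)))

end Maps

end RiemMap

end

noncomputable section

namespace RiemMap

set_option linter.unusedSectionVars false

/-! ### Derivatives of functions along vector fields and the Lie bracket. -/

section Functions

variable {E : Type*} [NormedAddCommGroup E] [NormedSpace ℝ E]
  {M : Type*} [TopologicalSpace M] [ChartedSpace E M] [IsManifold 𝓘(ℝ, E) ∞ M]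
  {G : Type*} [NormedAddCommGroup G] [NormedSpace ℝ G]

/-! Write `B = ∇dφ`. For a local field `X`, torsion-freeness of `∇^φ` gives `∇^φ_X dφ(V) = ∇^φ_V
dφ(X) + dφ([X,V])`. Applying `∇^φ_X` and commuting `∇^φ_X` with `∇^φ_V`, at the cost of the
curvature of `∇^φ`, turns `∇^φ_X ∇^φ_X dφ(V) + R^N(dφ V, dφ X) dφ X` into `∇^φ_X dφ([X,V]) + ∇^φ_V
∇^φ_X dφ(X) + ∇^φ_{[X,V]} dφ(X)`. The same computation on `M` gives the same expression without
`dφ`. Comparing the two through `∇^φ_a dφ(Y) = B(a,Y) + dφ(∇_a Y)` leaves only terms in `B`: the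
derivative `(∇_V B)(X,X)`, written `∇^φ_V(B(X,X)) - 2B(∇_V X, X)`, and `2B(X, ∇_X V)`. This is
`commutation_along`.

Summing over fields that are orthonormal at `x` gives the theorem once trace and covariant
derivative are known to commute (`pullbackConn_tension`). That follows from the compatibility of `∇`
with `g`: in a smooth frame that is orthonormal at `x`, the derivative of the inverse Gram matrix at
`x` supplies exactly the terms `-2B(∇_V e_i, e_i)`.

Two facts about `∇^φ` carry the argument: it is torsion-free (`pullbackConn_push_sub`) and its
curvature is the pull-back of `R^N` (`curvatureAlong_eq`). The connections are defined point by
point in charts that change with the point, so their iterates make sense only after smoothness is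
proved: for `∇` from the Koszul formula, for `∇^φ` by expanding sections in frames pulled back from
`N`. -/

theorem two_le_infty : (2 : ℕ∞ω) ≤ ∞ := by
  have : ((2 : ℕ∞) : ℕ∞ω) ≤ ((⊤ : ℕ∞) : ℕ∞ω) := WithTop.coe_le_coe.2 le_top
  exact this

/-- Treating `df` as a section of a Hom bundle means that `df(X)` inherits the regularity of `X`.
Both smooth and merely differentiable `X` are needed, since the test fields in `TensorialAt` are
only differentiable at the point. -/
theorem contMDiffAt_mvfderiv_section {f : M → G} {x : M} (hf : CMDiffAt ∞ f x) :
    ContMDiffAt 𝓘(ℝ, E) (𝓘(ℝ, E).prod 𝓘(ℝ, E →L[ℝ] G)) ∞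
      (fun y ↦ TotalSpace.mk' (E →L[ℝ] G)
        (E := fun y : M ↦ (TangentSpace 𝓘(ℝ, E) y →L[ℝ] Bundle.Trivial M G y)) y
        (mvfderiv 𝓘(ℝ, E) f y)) x := by
  rw [contMDiffAt_hom_bundle]
  refine ⟨contMDiffAt_id, (hf.mfderiv_const (m := ∞) (by simp)).congr_of_eventuallyEq ?_⟩
  refine Filter.Eventually.of_forall fun y ↦ ?_
  ext v
  simp [inTangentCoordinates, ContinuousLinearMap.inCoordinates, mvfderiv]
  rfl

theorem contMDiffAt_mvfderiv_apply {f : M → G} {X : Π x : M, TangentSpace 𝓘(ℝ, E) x} {x : M}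
    (hf : CMDiffAt ∞ f x) (hX : CMDiffAt ∞ (T% X) x) :
    CMDiffAt ∞ (fun y ↦ mvfderiv 𝓘(ℝ, E) f y (X y)) x := by
  have := (contMDiffAt_mvfderiv_section hf).clm_bundle_apply hX
  rw [contMDiffAt_totalSpace] at this
  exact this.2

theorem mdifferentiableAt_mvfderiv_apply {f : M → G} {X : Π x : M, TangentSpace 𝓘(ℝ, E) x} {x : M}
    (hf : CMDiffAt ∞ f x) (hX : MDiffAt (T% X) x) :
    MDiffAt (fun y ↦ mvfderiv 𝓘(ℝ, E) f y (X y)) x := by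
  have := ((contMDiffAt_mvfderiv_section hf).mdifferentiableAt (by simp)).clm_bundle_apply hX
  rw [mdifferentiableAt_totalSpace] at this
  exact this.2

/-- On the domain of the preferred chart at `x`, the derivative of `f` along a vector field with
constant components is the derivative of its coordinate expression. -/
theorem mvfderiv_extend {f : M → G} {x y : M} (hy : y ∈ (chartAt E x).source)
    (hf : MDiffAt f y) (b : TangentSpace 𝓘(ℝ, E) x) :
    mvfderiv 𝓘(ℝ, E) f y (extend E b y) =
      fderiv ℝ (f ∘ (extChartAt 𝓘(ℝ, E) x).symm) (extChartAt 𝓘(ℝ, E) x y)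
        (trivializationAt E (TangentSpace 𝓘(ℝ, E)) x ⟨x, b⟩).2 := by
  have hb : y ∈ (trivializationAt E (TangentSpace 𝓘(ℝ, E)) x).baseSet := hy
  have hy' : y ∈ (extChartAt 𝓘(ℝ, E) x).source := by simpa using hy
  have h := TangentBundle.symmL_trivializationAt (I := 𝓘(ℝ, E)) hy
  have h2 : extend E b y =
      (mfderivWithin 𝓘(ℝ, E) 𝓘(ℝ, E) (extChartAt 𝓘(ℝ, E) x).symm (Set.range 𝓘(ℝ, E))
        (extChartAt 𝓘(ℝ, E) x y)) (trivializationAt E (TangentSpace 𝓘(ℝ, E)) x ⟨x, b⟩).2 := by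
    rw [← h]
    exact (Trivialization.symmL_apply (R := ℝ) _ hb _).symm
  have hs : MDifferentiableAt 𝓘(ℝ, E) 𝓘(ℝ, E) (extChartAt 𝓘(ℝ, E) x).symm
      (extChartAt 𝓘(ℝ, E) x y) := by
    have := mdifferentiableWithinAt_extChartAt_symm (I := 𝓘(ℝ, E))
      ((extChartAt 𝓘(ℝ, E) x).map_source hy')
    rwa [modelWithCornersSelf_coe, Set.range_id, mdifferentiableWithinAt_univ] at this
  have e : (extChartAt 𝓘(ℝ, E) x).symm (extChartAt 𝓘(ℝ, E) x y) = y :=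
    (extChartAt 𝓘(ℝ, E) x).left_inv hy'
  rw [h2, ← mfderiv_eq_fderiv, mfderiv_comp_of_eq hf hs e, e, modelWithCornersSelf_coe,
    Set.range_id, mfderivWithin_univ]
  rfl

/-- The commutator of the derivatives along two vector fields is the derivative along their
bracket. -/
theorem mvfderiv_mlieBracket [FiniteDimensional ℝ E] {f : M → G} {x : M} (hf : CMDiffAt ∞ f x)
    {X Y : Π x : M, TangentSpace 𝓘(ℝ, E) x} (hX : MDiffAt (T% X) x) (hY : MDiffAt (T% Y) x) :
    mvfderiv 𝓘(ℝ, E) f x (VectorField.mlieBracket 𝓘(ℝ, E) X Y x) =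
      mvfderiv 𝓘(ℝ, E) (fun y ↦ mvfderiv 𝓘(ℝ, E) f y (Y y)) x (X x)
        - mvfderiv 𝓘(ℝ, E) (fun y ↦ mvfderiv 𝓘(ℝ, E) f y (X y)) x (Y x) := by
  -- The defect of the identity is antisymmetric and tensorial in each field, so it suffices to test
  -- it on fields with constant components in the chart at `x`. Their bracket vanishes at `x`, and
  -- what remains is the symmetry of the second derivative.
  let Φ (X Y : Π x : M, TangentSpace 𝓘(ℝ, E) x) : G :=
    mvfderiv 𝓘(ℝ, E) (fun y ↦ mvfderiv 𝓘(ℝ, E) f y (Y y)) x (X x)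
        - mvfderiv 𝓘(ℝ, E) (fun y ↦ mvfderiv 𝓘(ℝ, E) f y (X y)) x (Y x)
        - mvfderiv 𝓘(ℝ, E) f x (VectorField.mlieBracket 𝓘(ℝ, E) X Y x)
  have hanti (X Y) : Φ X Y = - Φ Y X := by
    simp only [Φ]
    rw [VectorField.mlieBracket_swap_apply]
    simp only [map_neg]
    abel
  have : IsManifold 𝓘(ℝ, E) 2 M := IsManifold.of_le (n := ∞) two_le_infty
  have h1 (Y : Π x : M, TangentSpace 𝓘(ℝ, E) x) (hY : MDiffAt (T% Y) x) :
      TensorialAt 𝓘(ℝ, E) E (Φ · Y) x :=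
    { smul := fun {a σ} ha hσ ↦ by
        have e1 : (fun y ↦ mvfderiv 𝓘(ℝ, E) f y ((a • σ) y)) =
            a • (fun y ↦ mvfderiv 𝓘(ℝ, E) f y (σ y)) := by
          funext y; simp
        simp only [Φ]
        rw [e1, mvfderiv_smul ha (mdifferentiableAt_mvfderiv_apply hf hσ),
          VectorField.mlieBracket_smul_left ha hσ]
        simp
        module
      add := fun {σ σ'} hσ hσ' ↦ by
        have e1 : (fun y ↦ mvfderiv 𝓘(ℝ, E) f y ((σ + σ') y)) =
            (fun y ↦ mvfderiv 𝓘(ℝ, E) f y (σ y)) + (fun y ↦ mvfderiv 𝓘(ℝ, E) f y (σ' y)) := by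
          funext y; simp
        simp only [Φ]
        rw [e1, mvfderiv_add (mdifferentiableAt_mvfderiv_apply hf hσ)
          (mdifferentiableAt_mvfderiv_apply hf hσ'), VectorField.mlieBracket_add_left hσ hσ']
        simp
        module }
  have h2 (X : Π x : M, TangentSpace 𝓘(ℝ, E) x) (hX : MDiffAt (T% X) x) :
      TensorialAt 𝓘(ℝ, E) E (Φ X ·) x :=
    { smul := fun {a σ} ha hσ ↦ by
        simp only [hanti X, (h1 X hX).smul ha hσ, smul_neg]
      add := fun {σ σ'} hσ hσ' ↦ by
        simp only [hanti X, (h1 X hX).add hσ hσ', neg_add] }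
  have key : Φ X Y = 0 := by
    rw [TensorialAt.pointwise₂ h1 h2 hX (mdifferentiableAt_extend 𝓘(ℝ, E) E (X x)) hY
      (mdifferentiableAt_extend 𝓘(ℝ, E) E (Y x)) (by simp) (by simp)]
    simp only [Φ, mlieBracket_extend, map_zero, sub_zero]
    have hF : ContDiffAt ℝ ∞ (f ∘ (extChartAt 𝓘(ℝ, E) x).symm) (extChartAt 𝓘(ℝ, E) x x) := by
      have h := (contMDiffAt_iff_source.1 hf)
      rwa [modelWithCornersSelf_coe, Set.range_id, contMDiffWithinAt_univ,
        contMDiffAt_iff_contDiffAt] at h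
    have hev : ∀ᶠ y in nhds x, MDiffAt f y :=
      ((contMDiffAt_iff_contMDiffAt_nhds (n := 1) (by simp)).1 (hf.of_le (by simp))).mono
        fun y hy ↦ hy.mdifferentiableAt (by simp)
    have step (b c : TangentSpace 𝓘(ℝ, E) x) :
        mvfderiv 𝓘(ℝ, E) (fun y ↦ mvfderiv 𝓘(ℝ, E) f y (extend E b y)) x c =
          fderiv ℝ (fderiv ℝ (f ∘ (extChartAt 𝓘(ℝ, E) x).symm)) (extChartAt 𝓘(ℝ, E) x x)
            (trivializationAt E (TangentSpace 𝓘(ℝ, E)) x ⟨x, c⟩).2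
            (trivializationAt E (TangentSpace 𝓘(ℝ, E)) x ⟨x, b⟩).2 := by
      have e1 : (fun y ↦ mvfderiv 𝓘(ℝ, E) f y (extend E b y)) =ᶠ[nhds x]
          fun y ↦ fderiv ℝ (f ∘ (extChartAt 𝓘(ℝ, E) x).symm) (extChartAt 𝓘(ℝ, E) x y)
            (trivializationAt E (TangentSpace 𝓘(ℝ, E)) x ⟨x, b⟩).2 := by
        filter_upwards [hev, chart_source_mem_nhds E x] with y hy hy'
        exact mvfderiv_extend hy' hy b
      rw [mvfderiv_congr e1]
      -- The direction `c` is itself written as the value of a constant-component field, so that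
      -- `mvfderiv_extend` also computes the outer derivative.
      have hc : extend E c x = c := by simp
      conv_lhs => rw [← hc]
      have hd : DifferentiableAt ℝ (fderiv ℝ (f ∘ (extChartAt 𝓘(ℝ, E) x).symm))
          (extChartAt 𝓘(ℝ, E) x x) :=
        (hF.fderiv_right (m := 1) two_le_infty).differentiableAt (by simp)
      have hd' : DifferentiableAt ℝ (fun u ↦ fderiv ℝ (f ∘ (extChartAt 𝓘(ℝ, E) x).symm) u
          (trivializationAt E (TangentSpace 𝓘(ℝ, E)) x ⟨x, b⟩).2) (extChartAt 𝓘(ℝ, E) x x) :=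
        hd.clm_apply (differentiableAt_const _)
      have hm : MDiffAt (fun y ↦ fderiv ℝ (f ∘ (extChartAt 𝓘(ℝ, E) x).symm)
          (extChartAt 𝓘(ℝ, E) x y) (trivializationAt E (TangentSpace 𝓘(ℝ, E)) x ⟨x, b⟩).2) x :=
        hd'.mdifferentiableAt.comp x
          (mdifferentiableAt_extChartAt (I := 𝓘(ℝ, E)) (mem_chart_source E x))
      rw [mvfderiv_extend (mem_chart_source E x) hm]
      have e2 : ((fun y ↦ fderiv ℝ (f ∘ (extChartAt 𝓘(ℝ, E) x).symm)
          (extChartAt 𝓘(ℝ, E) x y) (trivializationAt E (TangentSpace 𝓘(ℝ, E)) x ⟨x, b⟩).2) ∘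
          (extChartAt 𝓘(ℝ, E) x).symm) =ᶠ[nhds (extChartAt 𝓘(ℝ, E) x x)]
          fun u ↦ fderiv ℝ (f ∘ (extChartAt 𝓘(ℝ, E) x).symm) u
            (trivializationAt E (TangentSpace 𝓘(ℝ, E)) x ⟨x, b⟩).2 := by
        filter_upwards [extChartAt_target_mem_nhds (I := 𝓘(ℝ, E)) x] with u hu
        simp only [Function.comp_apply, (extChartAt 𝓘(ℝ, E) x).right_inv hu]
      rw [e2.fderiv_eq, fderiv_clm_apply hd (differentiableAt_const _)]
      simp
    rw [step, step, (hF.isSymmSndFDerivAt (by simpa using two_le_infty)).eq]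
    simp
  exact (sub_eq_zero.1 key).symm

end Functions

/-! ### Smooth dependence of the inverse matrix. -/

section Matrix

variable {E : Type*} [NormedAddCommGroup E] [NormedSpace ℝ E]
  {M : Type*} [TopologicalSpace M] [ChartedSpace E M]
  {n : Type*} [Fintype n] [DecidableEq n]

theorem contMDiffAt_det {A : M → Matrix n n ℝ} {x : M}
    (hA : ∀ i j, CMDiffAt ∞ (fun y ↦ A y i j) x) : CMDiffAt ∞ (fun y ↦ (A y).det) x := by
  simp_rw [Matrix.det_apply']
  exact ContMDiffAt.sum fun σ _ ↦ contMDiffAt_const.mul (ContMDiffAt.prod fun i _ ↦ hA _ _)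

/-- Cramer's rule: each entry of the adjugate is the determinant of `A` with one row replaced by a
constant one. -/
theorem contMDiffAt_matrix_inv {A : M → Matrix n n ℝ} {x : M}
    (hA : ∀ i j, CMDiffAt ∞ (fun y ↦ A y i j) x) (hdet : (A x).det ≠ 0) (i j : n) :
    CMDiffAt ∞ (fun y ↦ (A y)⁻¹ i j) x := by
  simp_rw [Matrix.inv_def, Matrix.smul_apply, Matrix.adjugate_apply, Ring.inverse_eq_inv',
    smul_eq_mul]
  refine ((contMDiffAt_det hA).inv₀ hdet).mul (contMDiffAt_det fun k l ↦ ?_)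
  by_cases h : k = j
  · subst h
    simp only [Matrix.updateRow_self]
    exact contMDiffAt_const
  · simp only [Matrix.updateRow_ne h]
    exact hA k l

end Matrix

/-! ### Gram matrices, the Koszul formula and smoothness of the Levi-Civita connection. -/

section Metric

variable {E : Type*} [NormedAddCommGroup E] [NormedSpace ℝ E]
  {M : Type*} [TopologicalSpace M] [ChartedSpace E M] [IsManifold 𝓘(ℝ, E) ∞ M]
  (g : ContMDiffRiemannianMetric 𝓘(ℝ, E) ∞ E (fun x : M ↦ TangentSpace 𝓘(ℝ, E) x))

theorem contMDiffAt_metric {σ τ : Π x : M, TangentSpace 𝓘(ℝ, E) x} {x : M}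
    (hσ : CMDiffAt ∞ (T% σ) x) (hτ : CMDiffAt ∞ (T% τ) x) :
    CMDiffAt ∞ (fun y ↦ g.inner y (σ y) (τ y)) x := by
  have : ContMDiffAt 𝓘(ℝ, E) (𝓘(ℝ, E).prod 𝓘(ℝ)) ∞
      (fun m ↦ TotalSpace.mk' ℝ (E := Bundle.Trivial M ℝ) m (g.inner m (σ m) (τ m))) x := by
    apply ContMDiffAt.clm_bundle_apply₂ (F₁ := E) (F₂ := E)
    · exact g.contMDiff.contMDiffAt
    · exact hσ
    · exact hτ
  rw [contMDiffAt_totalSpace] at this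
  exact this.2

/-- Order `∞` at `x` only provides, for each finite order, a neighbourhood that may shrink with the
order. Order one is enough for differentiability nearby. -/
theorem eventually_mdifferentiableAt_section {F : Type*} [NormedAddCommGroup F] [NormedSpace ℝ F]
    {V : M → Type*} [TopologicalSpace (TotalSpace F V)]
    [∀ x, AddCommGroup (V x)] [∀ x, Module ℝ (V x)] [∀ x, TopologicalSpace (V x)]
    [FiberBundle F V] [VectorBundle ℝ F V] [ContMDiffVectorBundle ∞ F V 𝓘(ℝ, E)]
    {x : M} {σ : Π x : M, V x} (hσ : CMDiffAt ∞ (T% σ) x) :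
    ∀ᶠ y in nhds x, MDiffAt (T% σ) y := by
  have : ContMDiffVectorBundle 1 F V 𝓘(ℝ, E) := .of_le (n := ∞) (by simp)
  exact ((contMDiffAt_iff_contMDiffAt_nhds (n := 1) (by simp)).1 (hσ.of_le (by simp))).mono
    fun y hy ↦ hy.mdifferentiableAt (by simp)

/-- The Gram matrix of a family of vectors. -/
def gram {ι : Type*} (x : M) (s : ι → TangentSpace 𝓘(ℝ, E) x) : Matrix ι ι ℝ :=
  Matrix.of fun i j ↦ g.inner x (s i) (s j)

variable [FiniteDimensional ℝ E]

theorem gram_eq_transpose_mul {ι : Type*} (x : M) (s : ι → TangentSpace 𝓘(ℝ, E) x) :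
    gram g x s = ((onb g x).toMatrix s).transpose * (onb g x).toMatrix s := by
  ext i j
  simp only [gram, Matrix.of_apply, Matrix.mul_apply, Matrix.transpose_apply,
    Module.Basis.toMatrix_apply]
  conv_lhs => rw [← (onb g x).sum_repr (s i), ← (onb g x).sum_repr (s j)]
  simp only [map_sum, map_smul, sum_apply, smul_apply, onb_orthonormal, smul_eq_mul]
  simp [mul_comm]

variable {x : M} (b : Module.Basis (Fin (Module.finrank ℝ E)) ℝ (TangentSpace 𝓘(ℝ, E) x))

/-- If `P` expresses the orthonormal basis in terms of `b` and `Q` is its inverse, the Gram matrix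
is `Qᵀ Q`, whose inverse is `P Pᵀ`. -/
theorem gram_inv_eq : (gram g x b)⁻¹ = b.toMatrix (onb g x) * (b.toMatrix (onb g x)).transpose := by
  refine Matrix.inv_eq_right_inv ?_
  rw [gram_eq_transpose_mul, Matrix.mul_assoc, ← Matrix.mul_assoc ((onb g x).toMatrix b),
    Module.Basis.toMatrix_mul_toMatrix_flip, Matrix.one_mul, ← Matrix.transpose_mul,
    Module.Basis.toMatrix_mul_toMatrix_flip, Matrix.transpose_one]

theorem gram_det_ne_zero : (gram g x b).det ≠ 0 := by
  have h : (onb g x).toMatrix b * b.toMatrix (onb g x) = 1 :=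
    Module.Basis.toMatrix_mul_toMatrix_flip _ _
  have h' := congrArg Matrix.det h
  rw [Matrix.det_mul, Matrix.det_one] at h'
  rw [gram_eq_transpose_mul, Matrix.det_mul, Matrix.det_transpose]
  have := left_ne_zero_of_mul_eq_one h'
  positivity

/-- The trace of a bilinear form with respect to `g`, computed in an arbitrary basis. -/
theorem sum_onb_eq_sum_gram_inv {W : Type*} [AddCommGroup W] [Module ℝ W]
    (B : TangentSpace 𝓘(ℝ, E) x →ₗ[ℝ] TangentSpace 𝓘(ℝ, E) x →ₗ[ℝ] W) :
    ∑ a, B (onb g x a) (onb g x a) = ∑ i, ∑ j, (gram g x b)⁻¹ i j • B (b i) (b j) := by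
  have h (a) : B (onb g x a) (onb g x a) =
      ∑ i, ∑ j, (b.toMatrix (onb g x) i a * b.toMatrix (onb g x) j a) • B (b i) (b j) := by
    conv_lhs => rw [← b.sum_repr (onb g x a)]
    simp only [map_sum, map_smul, LinearMap.sum_apply, LinearMap.smul_apply, Finset.smul_sum,
      smul_smul, Module.Basis.toMatrix_apply]
    rw [Finset.sum_comm]
    simp_rw [mul_comm]
  simp_rw [h, gram_inv_eq, Matrix.mul_apply, Matrix.transpose_apply, Finset.sum_smul]
  rw [Finset.sum_comm]
  exact Finset.sum_congr rfl fun i _ ↦ Finset.sum_comm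

/-- The coefficients of `W` in a smooth local frame are its inner products with the frame,
multiplied by the inverse Gram matrix, and the latter is smooth. -/
theorem contMDiffAt_of_inner {x : M} {W : Π x : M, TangentSpace 𝓘(ℝ, E) x}
    (hW : ∀ Z : Π x : M, TangentSpace 𝓘(ℝ, E) x, CMDiffAt ∞ (T% Z) x →
      CMDiffAt ∞ (fun y ↦ g.inner y (W y) (Z y)) x) : CMDiffAt ∞ (T% W) x := by
  let t := trivializationAt E (TangentSpace 𝓘(ℝ, E)) x
  have hx : x ∈ t.baseSet := mem_baseSet_trivializationAt E (TangentSpace 𝓘(ℝ, E)) x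
  let b := Module.finBasis ℝ E
  have hs (i) : CMDiffAt ∞ (T% (t.localFrame b i)) x :=
    contMDiffAt_localFrame_of_mem ∞ t b i hx
  rw [contMDiffAt_iff_localFrameCoeff b hx]
  intro i
  have hG (y : M) (hy : y ∈ t.baseSet) :
      gram g y (fun j ↦ t.localFrame b j y) = gram g y (t.basisAt b hy) := by
    congr 1
    funext j
    exact t.localFrame_apply_of_mem_baseSet b hy
  have hG' := contMDiffAt_matrix_inv (x := x) (A := fun y ↦ gram g y (fun j ↦ t.localFrame b j y))
    (fun i j ↦ contMDiffAt_metric g (hs i) (hs j))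
    (by rw [hG x hx]; exact gram_det_ne_zero g _)
  have hsum : CMDiffAt ∞ (fun y ↦ ∑ j, g.inner y (W y) (t.localFrame b j y) *
      (gram g y (fun j ↦ t.localFrame b j y))⁻¹ j i) x :=
    ContMDiffAt.sum fun j _ ↦ (hW _ (hs j)).mul (hG' j i)
  refine hsum.congr_of_eventuallyEq ?_
  filter_upwards [t.open_baseSet.mem_nhds hx] with y hy
  have hc := t.eq_sum_localFrameCoeff_smul (I := 𝓘(ℝ, E)) (b := b) (s := W) hy
  let c : Fin (Module.finrank ℝ E) → ℝ := fun i ↦ t.localFrameCoeff 𝓘(ℝ, E) b i y (W y)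
  have h1 : (fun j ↦ g.inner y (W y) (t.localFrame b j y)) =
      Matrix.vecMul c (gram g y (fun j ↦ t.localFrame b j y)) := by
    funext j
    conv_lhs => rw [hc]
    simp [Matrix.vecMul, dotProduct, gram, c]
  have h2 : c i = Matrix.vecMul (fun j ↦ g.inner y (W y) (t.localFrame b j y))
      (gram g y (fun j ↦ t.localFrame b j y))⁻¹ i := by
    rw [h1, Matrix.vecMul_vecMul, Matrix.mul_nonsing_inv, Matrix.vecMul_one]
    rw [hG y hy]
    exact (gram_det_ne_zero g _).isUnit
  exact h2

theorem leviCivita_sub {X Y : Π x : M, TangentSpace 𝓘(ℝ, E) x}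
    (hX : MDiffAt (T% X) x) (hY : MDiffAt (T% Y) x) :
    leviCivita g Y x (X x) - leviCivita g X x (Y x) = VectorField.mlieBracket 𝓘(ℝ, E) X Y x :=
  (leviCivita g).torsion_eq_zero_iff.1 (leviCivita_torsion g) hX hY

/-- The Koszul formula. -/
theorem inner_leviCivita {X Y Z : Π x : M, TangentSpace 𝓘(ℝ, E) x}
    (hX : MDiffAt (T% X) x) (hY : MDiffAt (T% Y) x) (hZ : MDiffAt (T% Z) x) :
    g.inner x (leviCivita g Y x (X x)) (Z x) = (1 / 2 : ℝ) *
      (mvfderiv 𝓘(ℝ, E) (fun y ↦ g.inner y (Y y) (Z y)) x (X x)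
        + mvfderiv 𝓘(ℝ, E) (fun y ↦ g.inner y (X y) (Z y)) x (Y x)
        - mvfderiv 𝓘(ℝ, E) (fun y ↦ g.inner y (X y) (Y y)) x (Z x)
        + g.inner x (VectorField.mlieBracket 𝓘(ℝ, E) X Y x) (Z x)
        - g.inner x (VectorField.mlieBracket 𝓘(ℝ, E) X Z x) (Y x)
        - g.inner x (VectorField.mlieBracket 𝓘(ℝ, E) Y Z x) (X x)) := by
  rw [leviCivita_metric g hY hZ, leviCivita_metric g hX hZ, leviCivita_metric g hX hY,
    ← leviCivita_sub g hX hY, ← leviCivita_sub g hX hZ, ← leviCivita_sub g hY hZ]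
  simp only [map_sub, sub_apply]
  rw [g.symm x (leviCivita g Z x (X x)) (Y x), g.symm x (leviCivita g X x (Z x)) (Y x),
    g.symm x (leviCivita g Z x (Y x)) (X x), g.symm x (leviCivita g Y x (Z x)) (X x)]
  ring

theorem contMDiffAt_mlieBracket {X Y : Π x : M, TangentSpace 𝓘(ℝ, E) x}
    (hX : CMDiffAt ∞ (T% X) x) (hY : CMDiffAt ∞ (T% Y) x) :
    CMDiffAt ∞ (T% (VectorField.mlieBracket 𝓘(ℝ, E) X Y)) x := by
  have : IsManifold 𝓘(ℝ, E) (((⊤ : ℕ∞) : ℕ∞ω) + 1) M := IsManifold.of_le (n := ∞) (by simp)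
  have : IsManifold 𝓘(ℝ, E) (minSmoothness ℝ 2) M :=
    IsManifold.of_le (n := ∞) (by simpa using two_le_infty)
  exact ContMDiffAt.mlieBracket_vectorField (n := ⊤) (m := ⊤) hX hY (by simp)

/-- The definition uses, at each point, the chart preferred there and a chosen orthonormal basis, so
it does not show smoothness in the point. The Koszul formula expresses the pairing with any smooth
`Z` by manifestly smooth terms. -/
theorem contMDiffAt_leviCivita {X Y : Π x : M, TangentSpace 𝓘(ℝ, E) x}
    (hX : CMDiffAt ∞ (T% X) x) (hY : CMDiffAt ∞ (T% Y) x) :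
    CMDiffAt ∞ (T% (fun y ↦ leviCivita g Y y (X y))) x := by
  refine contMDiffAt_of_inner g fun Z hZ ↦ ?_
  have h : CMDiffAt ∞ (fun y ↦ (1 / 2 : ℝ) *
      (mvfderiv 𝓘(ℝ, E) (fun y ↦ g.inner y (Y y) (Z y)) y (X y)
        + mvfderiv 𝓘(ℝ, E) (fun y ↦ g.inner y (X y) (Z y)) y (Y y)
        - mvfderiv 𝓘(ℝ, E) (fun y ↦ g.inner y (X y) (Y y)) y (Z y)
        + g.inner y (VectorField.mlieBracket 𝓘(ℝ, E) X Y y) (Z y)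
        - g.inner y (VectorField.mlieBracket 𝓘(ℝ, E) X Z y) (Y y)
        - g.inner y (VectorField.mlieBracket 𝓘(ℝ, E) Y Z y) (X y))) x :=
    contMDiffAt_const.mul (((((
      (contMDiffAt_mvfderiv_apply (contMDiffAt_metric g hY hZ) hX).add
      (contMDiffAt_mvfderiv_apply (contMDiffAt_metric g hX hZ) hY)).sub
      (contMDiffAt_mvfderiv_apply (contMDiffAt_metric g hX hY) hZ)).add
      (contMDiffAt_metric g (contMDiffAt_mlieBracket hX hY) hZ)).sub
      (contMDiffAt_metric g (contMDiffAt_mlieBracket hX hZ) hY)).sub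
      (contMDiffAt_metric g (contMDiffAt_mlieBracket hY hZ) hX))
  refine h.congr_of_eventuallyEq ?_
  filter_upwards [eventually_mdifferentiableAt_section hX, eventually_mdifferentiableAt_section hY,
    eventually_mdifferentiableAt_section hZ] with y h1 h2 h3
  exact inner_leviCivita g h1 h2 h3

end Metric

/-! ### Smooth and differentiable sections. -/

section Sections

variable {E : Type*} [NormedAddCommGroup E] [NormedSpace ℝ E]
  {M : Type*} [TopologicalSpace M] [ChartedSpace E M]
  {F : Type*} [NormedAddCommGroup F] [NormedSpace ℝ F]
  {V : M → Type*} [TopologicalSpace (TotalSpace F V)]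
  [∀ x, TopologicalSpace (V x)] [FiberBundle F V]

/-- The section `σ` is smooth at `x`. -/
abbrev SmoothSectionAt (E : Type*) [NormedAddCommGroup E] [NormedSpace ℝ E]
    {M : Type*} [TopologicalSpace M] [ChartedSpace E M]
    (F : Type*) [NormedAddCommGroup F] [NormedSpace ℝ F]
    {V : M → Type*} [TopologicalSpace (TotalSpace F V)]
    [∀ x, TopologicalSpace (V x)] [FiberBundle F V] (σ : Π x : M, V x) (x : M) : Prop :=
  ContMDiffAt 𝓘(ℝ, E) (𝓘(ℝ, E).prod 𝓘(ℝ, F)) ∞ (fun y ↦ TotalSpace.mk' F y (σ y)) x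

/-- The section `σ` is differentiable at `x`. -/
abbrev DiffSectionAt (E : Type*) [NormedAddCommGroup E] [NormedSpace ℝ E]
    {M : Type*} [TopologicalSpace M] [ChartedSpace E M]
    (F : Type*) [NormedAddCommGroup F] [NormedSpace ℝ F]
    {V : M → Type*} [TopologicalSpace (TotalSpace F V)]
    [∀ x, TopologicalSpace (V x)] [FiberBundle F V] (σ : Π x : M, V x) (x : M) : Prop :=
  MDifferentiableAt 𝓘(ℝ, E) (𝓘(ℝ, E).prod 𝓘(ℝ, F)) (fun y ↦ TotalSpace.mk' F y (σ y)) x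

theorem DiffSectionAt.congr {σ τ : Π x : M, V x} {x : M} (hσ : DiffSectionAt E F σ x)
    (h : ∀ᶠ y in nhds x, τ y = σ y) : DiffSectionAt E F τ x :=
  hσ.congr_of_eventuallyEq (h.mono fun y hy ↦ by simp [hy])

theorem SmoothSectionAt.congr {σ τ : Π x : M, V x} {x : M} (hσ : SmoothSectionAt E F σ x)
    (h : ∀ᶠ y in nhds x, τ y = σ y) : SmoothSectionAt E F τ x :=
  hσ.congr_of_eventuallyEq (h.mono fun y hy ↦ by simp [hy])

theorem smoothSectionAt_iff (σ : Π x : M, V x) (x : M) : SmoothSectionAt E F σ x ↔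
    CMDiffAt ∞ (fun y ↦ (trivializationAt F V x ⟨y, σ y⟩).2) x :=
  contMDiffAt_section ..

theorem diffSectionAt_iff (σ : Π x : M, V x) (x : M) : DiffSectionAt E F σ x ↔
    MDiffAt (fun y ↦ (trivializationAt F V x ⟨y, σ y⟩).2) x :=
  mdifferentiableAt_section ..

theorem SmoothSectionAt.diffSectionAt {σ : Π x : M, V x} {x : M} (hσ : SmoothSectionAt E F σ x) :
    DiffSectionAt E F σ x :=
  ContMDiffAt.mdifferentiableAt hσ (by simp)

end Sections

/-! ### Locality and Leibniz rules for a connection. -/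

section Connection

variable {E : Type*} [NormedAddCommGroup E] [NormedSpace ℝ E]
  {M : Type*} [TopologicalSpace M] [ChartedSpace E M]
  {F : Type*} [NormedAddCommGroup F] [NormedSpace ℝ F]
  {V : M → Type*} [TopologicalSpace (TotalSpace F V)]
  [∀ x, AddCommGroup (V x)] [∀ x, Module ℝ (V x)] [∀ x, TopologicalSpace (V x)]
  [∀ x, IsTopologicalAddGroup (V x)] [∀ x, ContinuousSMul ℝ (V x)]
  [FiberBundle F V]
  (D : CovariantDerivative 𝓘(ℝ, E) F V) {x : M}

theorem conn_congr {σ τ : Π x : M, V x} (hσ : DiffSectionAt E F σ x)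
    (h : ∀ᶠ y in nhds x, τ y = σ y) : D τ x = D σ x :=
  D.isCovariantDerivativeOnUniv.congr_of_eventuallyEq (DiffSectionAt.congr hσ h) hσ
    Filter.univ_mem h

variable [VectorBundle ℝ F V]

theorem conn_add {σ τ : Π x : M, V x} (hσ : DiffSectionAt E F σ x) (hτ : DiffSectionAt E F τ x)
    (v : TangentSpace 𝓘(ℝ, E) x) : D (fun y ↦ σ y + τ y) x v = D σ x v + D τ x v :=
  congrArg (fun L ↦ L v) (D.isCovariantDerivativeOnUniv.add hσ hτ)

theorem conn_smul {f : M → ℝ} {σ : Π x : M, V x} (hf : MDiffAt f x) (hσ : DiffSectionAt E F σ x)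
    (v : TangentSpace 𝓘(ℝ, E) x) :
    D (fun y ↦ f y • σ y) x v = mvfderiv 𝓘(ℝ, E) f x v • σ x + f x • D σ x v := by
  have h := congrArg (fun L ↦ L v) (D.isCovariantDerivativeOnUniv.leibniz hσ hf)
  refine h.trans ?_
  simp [add_comm]

theorem conn_sum {ι : Type*} (s : Finset ι) {σ : ι → Π x : M, V x}
    (hσ : ∀ i, DiffSectionAt E F (σ i) x) (v : TangentSpace 𝓘(ℝ, E) x) :
    D (fun y ↦ ∑ i ∈ s, σ i y) x v = ∑ i ∈ s, D (σ i) x v := by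
  classical
  induction s using Finset.induction_on with
  | empty =>
    simp only [Finset.sum_empty]
    have := D.isCovariantDerivativeOnUniv.zero (x := x)
    exact congrArg (fun L ↦ L v) this
  | insert a s ha ih =>
    simp only [Finset.sum_insert ha]
    rw [conn_add D (hσ a) (.sum_section fun i _ ↦ hσ i), ih]

theorem conn_sum_smul {ι : Type*} [Fintype ι] {f : ι → M → ℝ} {σ : ι → Π x : M, V x}
    (hf : ∀ i, MDiffAt (f i) x) (hσ : ∀ i, DiffSectionAt E F (σ i) x) (v : TangentSpace 𝓘(ℝ, E) x) :
    D (fun y ↦ ∑ i, f i y • σ i y) x v =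
      ∑ i, (mvfderiv 𝓘(ℝ, E) (f i) x v • σ i x + f i x • D (σ i) x v) := by
  rw [conn_sum D _ (σ := fun i y ↦ f i y • σ i y) fun i ↦ (hf i).smul_section (hσ i)]
  exact Finset.sum_congr rfl fun i _ ↦ conn_smul D (hf i) (hσ i) v

end Connection

/-! ### Sections of the pull-back bundle and frames along the map. -/

section Pullback

variable {E : Type*} [NormedAddCommGroup E] [NormedSpace ℝ E] [FiniteDimensional ℝ E]
  {M : Type*} [TopologicalSpace M] [ChartedSpace E M] [IsManifold 𝓘(ℝ, E) ∞ M]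
  {F : Type*} [NormedAddCommGroup F] [NormedSpace ℝ F] [FiniteDimensional ℝ F]
  {N : Type*} [TopologicalSpace N] [ChartedSpace F N] [IsManifold 𝓘(ℝ, F) ∞ N]
  (φ : C^∞⟮𝓘(ℝ, E), M; 𝓘(ℝ, F), N⟯) {x : M}

instance pullbackTangent_contMDiffVectorBundle :
    ContMDiffVectorBundle ∞ F (PullbackTangent φ) 𝓘(ℝ, E) :=
  ContMDiffVectorBundle.pullback F (fun y : N ↦ TangentSpace 𝓘(ℝ, F) y) 𝓘(ℝ, E) φ

instance pullbackTangent_contMDiffVectorBundle_one :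
    ContMDiffVectorBundle 1 F (PullbackTangent φ) 𝓘(ℝ, E) :=
  .of_le (n := ∞) (by simp)

/-- The section `W ∘ φ` of `φ⁻¹TN` given by a vector field `W` on `N`. -/
def pullSection (W : Π y : N, TangentSpace 𝓘(ℝ, F) y) : Π z : M, PullbackTangent φ z :=
  fun z ↦ W (φ z)

theorem smoothSectionAt_pullSection {W : Π y : N, TangentSpace 𝓘(ℝ, F) y}
    (hW : SmoothSectionAt F F W (φ x)) :
    SmoothSectionAt E F (pullSection φ W) x := by
  refine (smoothSectionAt_iff ..).2 ?_
  exact ContMDiffAt.comp (I' := 𝓘(ℝ, F)) (f := φ) x ((smoothSectionAt_iff ..).1 hW)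
    φ.contMDiff.contMDiffAt

theorem diffSectionAt_pullSection {W : Π y : N, TangentSpace 𝓘(ℝ, F) y}
    (hW : DiffSectionAt F F W (φ x)) :
    DiffSectionAt E F (pullSection φ W) x := by
  refine (diffSectionAt_iff ..).2 ?_
  exact MDifferentiableAt.comp (I' := 𝓘(ℝ, F)) (f := φ) x ((diffSectionAt_iff ..).1 hW)
    (φ.contMDiff.mdifferentiableAt (by simp))

theorem contMDiffAt_differential :
    ContMDiffAt 𝓘(ℝ, E) (𝓘(ℝ, E).prod 𝓘(ℝ, E →L[ℝ] F)) ∞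
      (fun y ↦ TotalSpace.mk' (E →L[ℝ] F)
        (E := fun y : M ↦ (TangentSpace 𝓘(ℝ, E) y →L[ℝ] PullbackTangent φ y)) y
        (differential φ y)) x := by
  rw [contMDiffAt_hom_bundle]
  refine ⟨contMDiffAt_id,
    (φ.contMDiff.contMDiffAt.mfderiv_const (m := ∞) (by simp)).congr_of_eventuallyEq ?_⟩
  refine Filter.Eventually.of_forall fun y ↦ ?_
  ext v
  simp [inTangentCoordinates, ContinuousLinearMap.inCoordinates]
  rfl

theorem push_apply (X : Π x : M, TangentSpace 𝓘(ℝ, E) x) (x : M) :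
    push φ X x = differential φ x (X x) := rfl

theorem smoothSectionAt_push {X : Π x : M, TangentSpace 𝓘(ℝ, E) x} (hX : SmoothSectionAt E E X x) :
    SmoothSectionAt E F (push φ X) x :=
  (contMDiffAt_differential φ).clm_bundle_apply hX

theorem diffSectionAt_push {X : Π x : M, TangentSpace 𝓘(ℝ, E) x} (hX : DiffSectionAt E E X x) :
    DiffSectionAt E F (push φ X) x :=
  ((contMDiffAt_differential φ).mdifferentiableAt (by simp)).clm_bundle_apply hX

/-- Near `x`, every smooth section of `φ⁻¹TN` is a combination, with smooth coefficients, of the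
pull-backs of a fixed finite family of vector fields on `N`. -/
theorem exists_frame_along (x : M) :
    ∃ (W : Fin (Module.finrank ℝ F) → Π y : N, TangentSpace 𝓘(ℝ, F) y)
      (C : Fin (Module.finrank ℝ F) → Π z : M, PullbackTangent φ z →ₗ[ℝ] ℝ),
      (∀ j, SmoothSectionAt F F (W j) (φ x)) ∧
      ∀ σ : Π z : M, PullbackTangent φ z, SmoothSectionAt E F σ x →
        (∀ j, CMDiffAt ∞ (fun z ↦ C j z (σ z)) x) ∧
        ∀ᶠ z in nhds x, σ z = ∑ j, C j z (σ z) • pullSection φ (W j) z := by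
  let t := trivializationAt F (TangentSpace 𝓘(ℝ, F)) (φ x)
  have hx : φ x ∈ t.baseSet := mem_baseSet_trivializationAt F (TangentSpace 𝓘(ℝ, F)) (φ x)
  let b := Module.finBasis ℝ F
  -- The coefficients are linear functionals on the fibres, so at each point they depend only on the
  -- value of the section there; tensoriality of the curvature relies on this.
  refine ⟨t.localFrame b, fun j z ↦ t.localFrameCoeff 𝓘(ℝ, F) b j (φ z),
    fun j ↦ contMDiffAt_localFrame_of_mem ∞ t b j hx, fun σ hσ ↦ ?_⟩
  -- The frame identities concern sections, so a single vector `v` is replaced by its extension.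
  have hcoeff (y : N) (hy : y ∈ t.baseSet) (v : TangentSpace 𝓘(ℝ, F) y) (j) :
      t.localFrameCoeff 𝓘(ℝ, F) b j y v = b.repr (t ⟨y, v⟩).2 j := by
    simpa using t.localFrameCoeff_eq_coeff (I := 𝓘(ℝ, F)) (b := b) (i := j) hy
      (s := extend F v)
  have hsum (y : N) (hy : y ∈ t.baseSet) (v : TangentSpace 𝓘(ℝ, F) y) :
      v = ∑ j, t.localFrameCoeff 𝓘(ℝ, F) b j y v • t.localFrame b j y := by
    simpa using t.eq_sum_localFrameCoeff_smul (I := 𝓘(ℝ, F)) (b := b) (s := extend F v) hy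
  have hbase : ∀ᶠ z in nhds x, φ z ∈ t.baseSet :=
    φ.contMDiff.continuous.continuousAt.preimage_mem_nhds (t.open_baseSet.mem_nhds hx)
  refine ⟨fun j ↦ ?_, ?_⟩
  · replace hσ := (smoothSectionAt_iff ..).1 hσ
    have h2 : CMDiffAt ∞ (fun z ↦ b.coord j (t ⟨φ z, σ z⟩).2) x :=
      (LinearMap.toContinuousLinearMap (b.coord j)).contMDiff.contMDiffAt.comp x hσ
    refine h2.congr_of_eventuallyEq ?_
    filter_upwards [hbase] with z hz
    exact hcoeff _ hz _ j
  · filter_upwards [hbase] with z hz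
    exact hsum _ hz _

end Pullback

theorem christoffel_symm {E : Type*} [NormedAddCommGroup E] [NormedSpace ℝ E]
    [FiniteDimensional ℝ E] {M : Type*} [TopologicalSpace M] [ChartedSpace E M]
    [IsManifold 𝓘(ℝ, E) ∞ M]
    (g : ContMDiffRiemannianMetric 𝓘(ℝ, E) ∞ E (fun x : M ↦ TangentSpace 𝓘(ℝ, E) x)) (x : M)
    (a b : TangentSpace 𝓘(ℝ, E) x) : christoffel g x a b = christoffel g x b a := by
  simp only [christoffel_apply]
  refine Finset.sum_congr rfl fun i _ ↦ ?_
  rw [metricDeriv_symm g x (onb g x i), add_comm (metricDeriv g x b a _)]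

/-! ### Smoothness and torsion-freeness of the pull-back connection. -/

section Along

variable {E : Type*} [NormedAddCommGroup E] [NormedSpace ℝ E] [FiniteDimensional ℝ E]
  {M : Type*} [TopologicalSpace M] [ChartedSpace E M] [IsManifold 𝓘(ℝ, E) ∞ M]
  {F : Type*} [NormedAddCommGroup F] [NormedSpace ℝ F] [FiniteDimensional ℝ F]
  {N : Type*} [TopologicalSpace N] [ChartedSpace F N] [IsManifold 𝓘(ℝ, F) ∞ N]
  (h : ContMDiffRiemannianMetric 𝓘(ℝ, F) ∞ F (fun y : N ↦ TangentSpace 𝓘(ℝ, F) y))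
  (φ : C^∞⟮𝓘(ℝ, E), M; 𝓘(ℝ, F), N⟯) {x : M}

/-- The covariant derivative of a vector field on `N`, on the fibers of `φ⁻¹TN`. -/
def leviCivitaAlong (W : Π y : N, TangentSpace 𝓘(ℝ, F) y) (x : M) :
    PullbackTangent φ x →L[ℝ] PullbackTangent φ x :=
  leviCivita h W (φ x)

theorem pullSection_leviCivita (W B : Π y : N, TangentSpace 𝓘(ℝ, F) y) (x : M) :
    pullSection φ (fun y ↦ leviCivita h W y (B y)) x =
      leviCivitaAlong h φ W x (pullSection φ B x) := rfl

theorem pullbackConn_pullSection {W : Π y : N, TangentSpace 𝓘(ℝ, F) y}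
    (hW : DiffSectionAt F F W (φ x)) (a : TangentSpace 𝓘(ℝ, E) x) :
    pullbackConn h φ (pullSection φ W) x a = leviCivitaAlong h φ W x (differential φ x a) :=
  pullbackConn_comp h φ W x hW a

theorem eventually_comp {p : N → Prop} (hp : ∀ᶠ y in nhds (φ x), p y) :
    ∀ᶠ z in nhds x, p (φ z) :=
  φ.contMDiff.continuous.continuousAt.eventually hp

/-- Expanding `dφ(X) = ∑ c_j S_j ∘ φ` in a pulled-back frame gives `∇^φ_X (W ∘ φ) = ∑ c_j (∇_{S_j}
W) ∘ φ`, which reduces the claim to smoothness on `N`. -/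
theorem smoothSectionAt_pullbackConn_pullSection {W : Π y : N, TangentSpace 𝓘(ℝ, F) y}
    {X : Π x : M, TangentSpace 𝓘(ℝ, E) x}
    (hW : SmoothSectionAt F F W (φ x)) (hX : SmoothSectionAt E E X x) :
    SmoothSectionAt E F (fun z ↦ pullbackConn h φ (pullSection φ W) z (X z)) x := by
  obtain ⟨S, C, hS, hexp⟩ := exists_frame_along φ x
  obtain ⟨hc, hsum⟩ := hexp _ (smoothSectionAt_push φ hX)
  set c := fun j z ↦ C j z (push φ X z)
  have h1 : SmoothSectionAt E F (V := PullbackTangent φ)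
      (fun z ↦ ∑ j, c j z • pullSection φ (fun y ↦ leviCivita h W y (S j y)) z) x :=
    ContMDiffAt.sum_section fun j _ ↦ (hc j).smul_section
      (smoothSectionAt_pullSection φ (contMDiffAt_leviCivita h (hS j) hW))
  refine h1.congr ?_
  filter_upwards [hsum, eventually_comp φ (eventually_mdifferentiableAt_section hW)] with z hz hWz
  rw [pullbackConn_pullSection h φ hWz]
  refine (congrArg (leviCivitaAlong h φ W z) hz).trans ?_
  simp only [map_sum, map_smul, pullSection_leviCivita]
  rfl

/-- The pull-back connection preserves smoothness. -/
theorem smoothSectionAt_pullbackConn {σ : Π z : M, PullbackTangent φ z}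
    {X : Π x : M, TangentSpace 𝓘(ℝ, E) x}
    (hσ : SmoothSectionAt E F σ x) (hX : SmoothSectionAt E E X x) :
    SmoothSectionAt E F (fun z ↦ pullbackConn h φ σ z (X z)) x := by
  obtain ⟨S, C, hS, hexp⟩ := exists_frame_along φ x
  obtain ⟨hc, hsum⟩ := hexp _ hσ
  set c := fun j z ↦ C j z (σ z)
  -- This is the Leibniz rule for `σ = ∑ c_j S_j ∘ φ`; every term is smooth by the case of
  -- pulled-back fields.
  have h1 : SmoothSectionAt E F (V := PullbackTangent φ)
      (fun z ↦ ∑ j, (mvfderiv 𝓘(ℝ, E) (c j) z (X z) • pullSection φ (S j) z +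
        c j z • pullbackConn h φ (pullSection φ (S j)) z (X z))) x :=
    ContMDiffAt.sum_section fun j _ ↦
      ((contMDiffAt_mvfderiv_apply (hc j) hX).smul_section
        (smoothSectionAt_pullSection φ (hS j))).add_section
      ((hc j).smul_section (smoothSectionAt_pullbackConn_pullSection h φ (hS j) hX))
  refine h1.congr ?_
  have hcd : ∀ᶠ z in nhds x, ∀ j, MDiffAt (c j) z := Filter.eventually_all.2 fun j ↦
    ((contMDiffAt_iff_contMDiffAt_nhds (n := 1) (by simp)).1 ((hc j).of_le (by simp))).mono
      fun y hy ↦ hy.mdifferentiableAt (by simp)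
  have hSd : ∀ᶠ z in nhds x, ∀ j, DiffSectionAt F F (S j) (φ z) :=
    Filter.eventually_all.2 fun j ↦ eventually_comp φ (eventually_mdifferentiableAt_section (hS j))
  -- The section is differentiated at `z`, so the expansion is needed on a neighbourhood of `z` and
  -- not only at `z`.
  filter_upwards [hsum.eventually_nhds, hcd, hSd] with z hz hcz hSz
  have hSz' (j) := diffSectionAt_pullSection φ (hSz j)
  rw [conn_congr (pullbackConn h φ)
    (MDifferentiableAt.sum_section fun j _ ↦ (hcz j).smul_section (hSz' j)) hz]
  exact conn_sum_smul _ hcz hSz' _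

/-- The components of `dφ(Y)` in the preferred trivialization at `x` are the derivatives along `Y`
of the coordinates of `φ`. -/
theorem trivialization_push {z : M} (hz : φ z ∈ (chartAt F (φ x)).source)
    (Y : Π x : M, TangentSpace 𝓘(ℝ, E) x) :
    (trivializationAt F (PullbackTangent φ) x ⟨z, push φ Y z⟩).2 =
      mvfderiv 𝓘(ℝ, E) (extChartAt 𝓘(ℝ, F) (φ x) ∘ φ) z (Y z) := by
  have h1 := TangentBundle.continuousLinearMapAt_trivializationAt (I := 𝓘(ℝ, F)) hz
  have h2 : mvfderiv 𝓘(ℝ, E) (extChartAt 𝓘(ℝ, F) (φ x) ∘ φ) z (Y z) =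
      mfderiv 𝓘(ℝ, F) 𝓘(ℝ, F) (extChartAt 𝓘(ℝ, F) (φ x)) (φ z)
        (mfderiv 𝓘(ℝ, E) 𝓘(ℝ, F) φ z (Y z)) :=
    mfderiv_comp_apply (I' := 𝓘(ℝ, F)) z (mdifferentiableAt_extChartAt hz)
      (φ.contMDiff.mdifferentiableAt (by simp)) _
  rw [h2, ← h1]
  have hb : φ z ∈ (trivializationAt F (TangentSpace 𝓘(ℝ, F)) (φ x)).baseSet := hz
  exact (Trivialization.continuousLinearMapAt_apply_of_mem (R := ℝ) _ hb _).symm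

theorem christoffelAlong_push (X Y : Π x : M, TangentSpace 𝓘(ℝ, E) x) :
    christoffelAlong h φ x (push φ Y x) (X x) = christoffelAlong h φ x (push φ X x) (Y x) := by
  exact christoffel_symm h (φ x) _ _

/-- The pull-back connection is torsion-free. -/
theorem pullbackConn_push_sub {X Y : Π x : M, TangentSpace 𝓘(ℝ, E) x}
    (hX : DiffSectionAt E E X x) (hY : DiffSectionAt E E Y x) :
    pullbackConn h φ (push φ Y) x (X x) - pullbackConn h φ (push φ X) x (Y x) =
      push φ (VectorField.mlieBracket 𝓘(ℝ, E) X Y) x := by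
  -- With `u` the chart at `φ x` composed with `φ`, the components of `dφ(Y)` are `Y(u)`. Hence
  -- `∇^φ_X dφ(Y)` is `X(Y(u))` plus a Christoffel term symmetric in `X` and `Y`; antisymmetrizing
  -- leaves `[X,Y](u)`, the components of `dφ([X,Y])`.
  have e (Y : Π x : M, TangentSpace 𝓘(ℝ, E) x) (a : TangentSpace 𝓘(ℝ, E) x) :
      pullbackConn h φ (push φ Y) x a = (trivializationAt F (PullbackTangent φ) x).symmL ℝ x
        (mvfderiv 𝓘(ℝ, E) (fun z ↦ mvfderiv 𝓘(ℝ, E) (extChartAt 𝓘(ℝ, F) (φ x) ∘ φ) z (Y z)) x a)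
        + christoffelAlong h φ x (push φ Y x) a := by
    have h3 : (fun z ↦ (trivializationAt F (PullbackTangent φ) x ⟨z, push φ Y z⟩).2) =ᶠ[nhds x]
        fun z ↦ mvfderiv 𝓘(ℝ, E) (extChartAt 𝓘(ℝ, F) (φ x) ∘ φ) z (Y z) := by
      filter_upwards [eventually_comp φ (chart_source_mem_nhds F (φ x))] with z hz
      exact trivialization_push φ hz Y
    rw [← mvfderiv_congr h3]
    rfl
  have hf : CMDiffAt ∞ (extChartAt 𝓘(ℝ, F) (φ x) ∘ φ) x :=
    ContMDiffAt.comp x (contMDiffAt_extChartAt (I := 𝓘(ℝ, F))) φ.contMDiff.contMDiffAt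
  rw [e, e, christoffelAlong_push, add_sub_add_right_eq_sub, ← map_sub,
    ← mvfderiv_mlieBracket hf hX hY,
    ← trivialization_push φ (mem_chart_source F (φ x))]
  have hx := mem_baseSet_trivializationAt F (PullbackTangent φ) x
  rw [Trivialization.symmL_apply _ hx]
  exact Trivialization.symm_apply_apply_mk _ hx _

end Along

/-! ### The curvature of the pull-back connection. -/

section Curvature

variable {E : Type*} [NormedAddCommGroup E] [NormedSpace ℝ E] [FiniteDimensional ℝ E]
  {M : Type*} [TopologicalSpace M] [ChartedSpace E M] [IsManifold 𝓘(ℝ, E) ∞ M]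
  {F : Type*} [NormedAddCommGroup F] [NormedSpace ℝ F] [FiniteDimensional ℝ F]
  {N : Type*} [TopologicalSpace N] [ChartedSpace F N] [IsManifold 𝓘(ℝ, F) ∞ N]
  (h : ContMDiffRiemannianMetric 𝓘(ℝ, F) ∞ F (fun y : N ↦ TangentSpace 𝓘(ℝ, F) y))
  (φ : C^∞⟮𝓘(ℝ, E), M; 𝓘(ℝ, F), N⟯) {x : M}

theorem eventually_mdifferentiableAt_coeff {ι : Type*} [Finite ι] {c : ι → M → ℝ}
    (hc : ∀ j, CMDiffAt ∞ (c j) x) : ∀ᶠ z in nhds x, ∀ j, MDiffAt (c j) z :=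
  Filter.eventually_all.2 fun j ↦
    ((contMDiffAt_iff_contMDiffAt_nhds (n := 1) (by simp)).1 ((hc j).of_le (by simp))).mono
      fun _ hy ↦ hy.mdifferentiableAt (by simp)

/-- The curvature of the pull-back connection, on vector fields and sections. -/
def curvatureAlong (X Y : Π x : M, TangentSpace 𝓘(ℝ, E) x) (σ : Π z : M, PullbackTangent φ z)
    (x : M) : PullbackTangent φ x :=
  pullbackConn h φ (fun z ↦ pullbackConn h φ σ z (Y z)) x (X x)
    - pullbackConn h φ (fun z ↦ pullbackConn h φ σ z (X z)) x (Y x)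
    - pullbackConn h φ σ x (VectorField.mlieBracket 𝓘(ℝ, E) X Y x)

theorem pullbackConn_pullbackConn_congr {σ τ : Π z : M, PullbackTangent φ z}
    {Y : Π x : M, TangentSpace 𝓘(ℝ, E) x} (hσ : SmoothSectionAt E F σ x)
    (hY : SmoothSectionAt E E Y x) (hτ : ∀ᶠ z in nhds x, τ z = σ z)
    (a : TangentSpace 𝓘(ℝ, E) x) :
    pullbackConn h φ (fun z ↦ pullbackConn h φ τ z (Y z)) x a =
      pullbackConn h φ (fun z ↦ pullbackConn h φ σ z (Y z)) x a := by
  rw [conn_congr (pullbackConn h φ) (smoothSectionAt_pullbackConn h φ hσ hY).diffSectionAt]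
  filter_upwards [eventually_mdifferentiableAt_section hσ, hτ.eventually_nhds] with z hz hz'
  rw [conn_congr (pullbackConn h φ) hz hz']

theorem pullbackConn_pullbackConn_sum_smul {ι : Type*} [Fintype ι] {c : ι → M → ℝ}
    {σ : ι → Π z : M, PullbackTangent φ z} {Y : Π x : M, TangentSpace 𝓘(ℝ, E) x}
    (hc : ∀ j, CMDiffAt ∞ (c j) x) (hσ : ∀ j, SmoothSectionAt E F (σ j) x)
    (hY : SmoothSectionAt E E Y x) (a : TangentSpace 𝓘(ℝ, E) x) :
    pullbackConn h φ (fun z ↦ pullbackConn h φ (fun z ↦ ∑ j, c j z • σ j z) z (Y z)) x a =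
      ∑ j, (mvfderiv 𝓘(ℝ, E) (fun z ↦ mvfderiv 𝓘(ℝ, E) (c j) z (Y z)) x a • σ j x
        + mvfderiv 𝓘(ℝ, E) (c j) x (Y x) • pullbackConn h φ (σ j) x a
        + (mvfderiv 𝓘(ℝ, E) (c j) x a • pullbackConn h φ (σ j) x (Y x)
        + c j x • pullbackConn h φ (fun z ↦ pullbackConn h φ (σ j) z (Y z)) x a)) := by
  have hdc (j) : MDiffAt (fun z ↦ mvfderiv 𝓘(ℝ, E) (c j) z (Y z)) x :=
    (contMDiffAt_mvfderiv_apply (hc j) hY).mdifferentiableAt (by simp)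
  have hDσ (j) := (smoothSectionAt_pullbackConn h φ (hσ j) hY).diffSectionAt
  have hcd (j) : MDiffAt (c j) x := (hc j).mdifferentiableAt (by simp)
  have h1 (j) : DiffSectionAt E F
      (fun z ↦ mvfderiv 𝓘(ℝ, E) (c j) z (Y z) • σ j z) x :=
    (hdc j).smul_section (hσ j).diffSectionAt
  have h2 (j) : DiffSectionAt E F
      (fun z ↦ c j z • pullbackConn h φ (σ j) z (Y z)) x :=
    (hcd j).smul_section (hDσ j)
  have h12 (j) : DiffSectionAt E F (fun z ↦ mvfderiv 𝓘(ℝ, E) (c j) z (Y z) • σ j z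
      + c j z • pullbackConn h φ (σ j) z (Y z)) x :=
    mdifferentiableAt_add_section (h1 j) (h2 j)
  rw [conn_congr (pullbackConn h φ) (σ := fun z ↦ ∑ j, (mvfderiv 𝓘(ℝ, E) (c j) z (Y z) • σ j z
    + c j z • pullbackConn h φ (σ j) z (Y z))) (MDifferentiableAt.sum_section fun j _ ↦ h12 j)]
  · rw [conn_sum (pullbackConn h φ) _ h12]
    refine Finset.sum_congr rfl fun j _ ↦ ?_
    rw [conn_add _ (h1 j) (h2 j), conn_smul _ (hdc j) (hσ j).diffSectionAt,
      conn_smul _ (hcd j) (hDσ j)]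
  · filter_upwards [eventually_mdifferentiableAt_coeff hc,
      Filter.eventually_all.2 fun j ↦ eventually_mdifferentiableAt_section (hσ j)] with z h1 h2
    exact conn_sum_smul _ h1 h2 _

/-- In the twofold Leibniz expansion, the terms with one derivative on `c_j` and one on `σ_j` are
symmetric in `X` and `Y` and cancel. The second derivatives of `c_j` combine to `[X,Y](c_j)`, which
the bracket term removes. -/
theorem curvatureAlong_sum_smul {ι : Type*} [Fintype ι] {c : ι → M → ℝ}
    {σ : ι → Π z : M, PullbackTangent φ z} {X Y : Π x : M, TangentSpace 𝓘(ℝ, E) x}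
    (hc : ∀ j, CMDiffAt ∞ (c j) x) (hσ : ∀ j, SmoothSectionAt E F (σ j) x)
    (hX : SmoothSectionAt E E X x) (hY : SmoothSectionAt E E Y x) :
    curvatureAlong h φ X Y (fun z ↦ ∑ j, c j z • σ j z) x =
      ∑ j, c j x • curvatureAlong h φ X Y (σ j) x := by
  simp only [curvatureAlong]
  rw [pullbackConn_pullbackConn_sum_smul h φ hc hσ hY, pullbackConn_pullbackConn_sum_smul h φ hc hσ hX,
    conn_sum_smul _ (fun j ↦ (hc j).mdifferentiableAt (by simp)) (fun j ↦ (hσ j).diffSectionAt),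
    ← Finset.sum_sub_distrib, ← Finset.sum_sub_distrib]
  refine Finset.sum_congr rfl fun j _ ↦ ?_
  rw [mvfderiv_mlieBracket (hc j) hX.diffSectionAt hY.diffSectionAt]
  module

/-- The curvature of the pull-back connection depends only on the value of the section at the
point. -/
theorem curvatureAlong_congr {σ τ : Π z : M, PullbackTangent φ z}
    {X Y : Π x : M, TangentSpace 𝓘(ℝ, E) x}
    (hσ : SmoothSectionAt E F σ x) (hτ : SmoothSectionAt E F τ x)
    (hX : SmoothSectionAt E E X x) (hY : SmoothSectionAt E E Y x) (hστ : σ x = τ x) :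
    curvatureAlong h φ X Y σ x = curvatureAlong h φ X Y τ x := by
  obtain ⟨S, C, hS, hexp⟩ := exists_frame_along φ x
  -- The right-hand side involves `σ` only through `σ x`, so equal values give equal curvature.
  have key {σ : Π z : M, PullbackTangent φ z} (hσ : SmoothSectionAt E F σ x) :
      curvatureAlong h φ X Y σ x =
        ∑ j, C j x (σ x) • curvatureAlong h φ X Y (pullSection φ (S j)) x := by
    obtain ⟨hc, hsum⟩ := hexp _ hσ
    have hS' (j) := smoothSectionAt_pullSection φ (hS j)
    rw [← curvatureAlong_sum_smul h φ hc hS' hX hY]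
    have hs : SmoothSectionAt E F (fun z ↦ ∑ j, C j z (σ z) • pullSection φ (S j) z) x :=
      hσ.congr (hsum.mono fun _ h ↦ h.symm)
    simp only [curvatureAlong]
    rw [pullbackConn_pullbackConn_congr h φ hs hX hsum,
      pullbackConn_pullbackConn_congr h φ hs hY hsum, conn_congr _ hs.diffSectionAt hsum]
  rw [key hσ, key hτ, hστ]

/-- The second covariant derivative of a section `W ∘ φ`. -/
theorem pullbackConn_pullbackConn_pullSection {W B : Π y : N, TangentSpace 𝓘(ℝ, F) y}
    {Y : Π x : M, TangentSpace 𝓘(ℝ, E) x} (hW : SmoothSectionAt F F W (φ x))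
    (hB : SmoothSectionAt F F B (φ x)) (hY : SmoothSectionAt E E Y x)
    (hBY : push φ Y x = pullSection φ B x) (a : TangentSpace 𝓘(ℝ, E) x) :
    pullbackConn h φ (fun z ↦ pullbackConn h φ (pullSection φ W) z (Y z)) x a =
      leviCivitaAlong h φ (fun y ↦ leviCivita h W y (B y)) x (differential φ x a)
        + leviCivitaAlong h φ W x (pullbackConn h φ (push φ Y) x a
          - leviCivitaAlong h φ B x (differential φ x a)) := by
  -- Near `x` the field `dφ(Y)` need not be a pull-back, and `B ∘ φ` agrees with it only at `x`.
  -- Their difference is `∑ q_j S_j ∘ φ` with `q_j(x) = 0`, so differentiating at `x` only sees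
  -- `dq_j(a)`. By `e1`, `∑ dq_j(a) S_j` is `∇^φ_a dφ(Y) - ∇_{dφ(a)} B`, which is the argument of
  -- the correction term.
  obtain ⟨S, C, hS, hexp⟩ := exists_frame_along φ x
  have hpY := smoothSectionAt_push φ hY
  have hpB := smoothSectionAt_pullSection φ hB
  obtain ⟨hq, hsum⟩ := hexp (fun z ↦ push φ Y z - pullSection φ B z) (hpY.sub_section hpB)
  set q := fun j z ↦ C j z (push φ Y z - pullSection φ B z) with hqdef
  have hq0 (j) : q j x = 0 := by simp [hqdef, hBY]
  have hsum' : ∀ᶠ z in nhds x, push φ Y z = pullSection φ B z + ∑ j, q j z • pullSection φ (S j) z := by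
    filter_upwards [hsum] with z hz
    exact sub_eq_iff_eq_add'.1 hz
  have hqd (j) : MDiffAt (q j) x := (hq j).mdifferentiableAt (by simp)
  have hSd (j) := (smoothSectionAt_pullSection φ (hS j)).diffSectionAt
  have hBW : SmoothSectionAt F F (fun y ↦ leviCivita h W y (B y)) (φ x) :=
    contMDiffAt_leviCivita h hB hW
  have hSW (j) : SmoothSectionAt F F (fun y ↦ leviCivita h W y (S j y)) (φ x) :=
    contMDiffAt_leviCivita h (hS j) hW
  have hBWd := (smoothSectionAt_pullSection φ hBW).diffSectionAt
  have hSWd (j) := (smoothSectionAt_pullSection φ (hSW j)).diffSectionAt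
  have hsumd : DiffSectionAt E F (fun z ↦ ∑ j, q j z • pullSection φ (S j) z) x :=
    MDifferentiableAt.sum_section fun j _ ↦ (hqd j).smul_section (hSd j)
  have hsumd' : DiffSectionAt E F
      (fun z ↦ ∑ j, q j z • pullSection φ (fun y ↦ leviCivita h W y (S j y)) z) x :=
    MDifferentiableAt.sum_section fun j _ ↦ (hqd j).smul_section (hSWd j)
  have e1 : pullbackConn h φ (push φ Y) x a =
      leviCivitaAlong h φ B x (differential φ x a) +
        ∑ j, mvfderiv 𝓘(ℝ, E) (q j) x a • pullSection φ (S j) x := by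
    rw [conn_congr (pullbackConn h φ) (mdifferentiableAt_add_section hpB.diffSectionAt hsumd) hsum']
    refine (conn_add (pullbackConn h φ) hpB.diffSectionAt hsumd a).trans ?_
    rw [conn_sum_smul _ hqd hSd, pullbackConn_pullSection h φ hB.diffSectionAt]
    simp only [hq0, zero_smul, add_zero]
  have e2 : ∀ᶠ z in nhds x, pullbackConn h φ (pullSection φ W) z (Y z) =
      pullSection φ (fun y ↦ leviCivita h W y (B y)) z +
        ∑ j, q j z • pullSection φ (fun y ↦ leviCivita h W y (S j y)) z := by
    filter_upwards [hsum', eventually_comp φ (eventually_mdifferentiableAt_section hW)] with z hz hWz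
    rw [pullbackConn_pullSection h φ hWz, show differential φ z (Y z) = push φ Y z from rfl, hz]
    simp only [map_add, map_sum, map_smul, pullSection_leviCivita]
  rw [conn_congr (pullbackConn h φ) (mdifferentiableAt_add_section hBWd hsumd') e2]
  refine (conn_add (pullbackConn h φ) hBWd hsumd' a).trans ?_
  rw [conn_sum_smul _ hqd hSWd, pullbackConn_pullSection h φ hBW.diffSectionAt, e1,
    add_sub_cancel_left]
  simp only [hq0, zero_smul, add_zero, map_sum, map_smul, pullSection_leviCivita]

/-- The curvature tensor of `h` on the fibers of `φ⁻¹TN`. -/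
def pullbackCurvature (x : M) (a b c : PullbackTangent φ x) : PullbackTangent φ x :=
  curvature h (φ x) a b c

/-- The curvature of the pull-back connection is the pull-back of the curvature of `h`. -/
theorem curvatureAlong_eq {X Y : Π x : M, TangentSpace 𝓘(ℝ, E) x}
    {σ : Π z : M, PullbackTangent φ z} (hσ : SmoothSectionAt E F σ x)
    (hX : SmoothSectionAt E E X x) (hY : SmoothSectionAt E E Y x) :
    curvatureAlong h φ X Y σ x = pullbackCurvature h φ x (push φ X x) (push φ Y x) (σ x) := by
  let A : Π y : N, TangentSpace 𝓘(ℝ, F) y := extend F (x := φ x) (push φ X x)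
  let B : Π y : N, TangentSpace 𝓘(ℝ, F) y := extend F (x := φ x) (push φ Y x)
  let W : Π y : N, TangentSpace 𝓘(ℝ, F) y := extend F (x := φ x) (σ x)
  have hA : SmoothSectionAt F F A (φ x) := contMDiffAt_extend 𝓘(ℝ, F) F _
  have hB : SmoothSectionAt F F B (φ x) := contMDiffAt_extend 𝓘(ℝ, F) F _
  have hW : SmoothSectionAt F F W (φ x) := contMDiffAt_extend 𝓘(ℝ, F) F _
  have eA : A (φ x) = push φ X x := extend_apply_self ..
  have eB : B (φ x) = push φ Y x := extend_apply_self ..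
  have eW : W (φ x) = σ x := extend_apply_self ..
  rw [curvatureAlong_congr h φ hσ (smoothSectionAt_pullSection φ hW) hX hY eW.symm]
  -- Torsion-freeness on `N` writes `[A,B]` through `∇B` and `∇A`. These terms match the corrections
  -- that arise because `A ∘ φ` and `B ∘ φ` agree with `dφ(X)` and `dφ(Y)` only at `x`; the
  -- remaining corrections cancel by torsion-freeness of `∇^φ`.
  have hR : leviCivitaAlong h φ W x (VectorField.mlieBracket 𝓘(ℝ, F) A B (φ x)) =
      leviCivitaAlong h φ W x (leviCivitaAlong h φ B x (push φ X x)) -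
      leviCivitaAlong h φ W x (leviCivitaAlong h φ A x (push φ Y x)) := by
    rw [← leviCivita_sub h hA.diffSectionAt hB.diffSectionAt, ← map_sub, eA, eB]
    rfl
  unfold curvatureAlong
  rw [pullbackConn_pullbackConn_pullSection h φ hW hB hY eB.symm,
    pullbackConn_pullbackConn_pullSection h φ hW hA hX eA.symm,
    pullbackConn_pullSection h φ hW.diffSectionAt]
  have e : differential φ x (VectorField.mlieBracket 𝓘(ℝ, E) X Y x) =
      pullbackConn h φ (push φ Y) x (X x) - pullbackConn h φ (push φ X) x (Y x) :=
    (pullbackConn_push_sub h φ hX.diffSectionAt hY.diffSectionAt).symm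
  -- This holds by definition because `A`, `B`, `W` are the very extensions used in `curvature`.
  have key : pullbackCurvature h φ x (push φ X x) (push φ Y x) (σ x) =
      leviCivitaAlong h φ (fun y ↦ leviCivita h W y (B y)) x (push φ X x)
        - leviCivitaAlong h φ (fun y ↦ leviCivita h W y (A y)) x (push φ Y x)
        - leviCivitaAlong h φ W x (VectorField.mlieBracket 𝓘(ℝ, F) A B (φ x)) := rfl
  rw [key, hR, e]
  simp only [map_sub, push_apply]
  abel

end Curvature

/-! ### The second fundamental form and the derivative of its trace. -/

section SecondFundamentalForm

variable {E : Type*} [NormedAddCommGroup E] [NormedSpace ℝ E] [FiniteDimensional ℝ E]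
  {M : Type*} [TopologicalSpace M] [ChartedSpace E M] [IsManifold 𝓘(ℝ, E) ∞ M]
  (g : ContMDiffRiemannianMetric 𝓘(ℝ, E) ∞ E (fun x : M ↦ TangentSpace 𝓘(ℝ, E) x))
  {F : Type*} [NormedAddCommGroup F] [NormedSpace ℝ F] [FiniteDimensional ℝ F]
  {N : Type*} [TopologicalSpace N] [ChartedSpace F N] [IsManifold 𝓘(ℝ, F) ∞ N]
  (h : ContMDiffRiemannianMetric 𝓘(ℝ, F) ∞ F (fun y : N ↦ TangentSpace 𝓘(ℝ, F) y))
  (φ : C^∞⟮𝓘(ℝ, E), M; 𝓘(ℝ, F), N⟯) {x : M}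

theorem diffSectionAt_extend (b : TangentSpace 𝓘(ℝ, E) x) : DiffSectionAt E E (extend E b) x :=
  mdifferentiableAt_extend 𝓘(ℝ, E) E b

theorem smoothSectionAt_extend (b : TangentSpace 𝓘(ℝ, E) x) : SmoothSectionAt E E (extend E b) x :=
  contMDiffAt_extend 𝓘(ℝ, E) E b

/-- The difference is tensorial in `Y`: on `f Y`, the term `df(a) dφ(Y)` appears in both parts and
cancels. The extension chosen in the definition therefore does not matter. -/
theorem secondFundamentalForm_eq {Y : Π x : M, TangentSpace 𝓘(ℝ, E) x}
    (hY : DiffSectionAt E E Y x) (a : TangentSpace 𝓘(ℝ, E) x) :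
    secondFundamentalForm g h φ x a (Y x) =
      pullbackConn h φ (push φ Y) x a - differential φ x (leviCivita g Y x a) := by
  let Φ (Y : Π x : M, TangentSpace 𝓘(ℝ, E) x) : PullbackTangent φ x :=
    pullbackConn h φ (push φ Y) x a - differential φ x (leviCivita g Y x a)
  have hΦ : TensorialAt 𝓘(ℝ, E) E Φ x :=
    { smul := fun {f σ} hf hσ ↦ by
        have e1 : push φ (f • σ) = fun y ↦ f y • push φ σ y := by
          funext y; simp [push]
        have e2 := conn_smul (leviCivita g) hf hσ a
        have e2' : leviCivita g (f • σ) x a =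
          mvfderiv 𝓘(ℝ, E) f x a • σ x + f x • leviCivita g σ x a := e2
        simp only [Φ]
        rw [e1, conn_smul (pullbackConn h φ) hf (diffSectionAt_push φ hσ), e2', map_add, map_smul,
          map_smul, push_apply]
        module
      add := fun {σ σ'} hσ hσ' ↦ by
        have e1 : push φ (σ + σ') = fun y ↦ push φ σ y + push φ σ' y := by
          funext y; simp [push]
        have e2 : leviCivita g (σ + σ') x a = leviCivita g σ x a + leviCivita g σ' x a :=
          conn_add (leviCivita g) hσ hσ' a
        simp only [Φ]
        rw [e1, conn_add (pullbackConn h φ) (diffSectionAt_push φ hσ) (diffSectionAt_push φ hσ'), e2,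
          map_add]
        module }
  exact hΦ.pointwise (diffSectionAt_extend _) hY (by simp)

theorem pullbackConn_push {Y : Π x : M, TangentSpace 𝓘(ℝ, E) x}
    (hY : DiffSectionAt E E Y x) (a : TangentSpace 𝓘(ℝ, E) x) :
    pullbackConn h φ (push φ Y) x a =
      secondFundamentalForm g h φ x a (Y x) + differential φ x (leviCivita g Y x a) := by
  rw [secondFundamentalForm_eq g h φ hY, sub_add_cancel]

/-- Both connections are torsion-free, so the antisymmetric part is `dφ` of a bracket minus itself.
-/
theorem secondFundamentalForm_symm (a b : TangentSpace 𝓘(ℝ, E) x) :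
    secondFundamentalForm g h φ x a b = secondFundamentalForm g h φ x b a := by
  have ha := diffSectionAt_extend (E := E) a
  have hb := diffSectionAt_extend (E := E) b
  have h1 := pullbackConn_push_sub h φ ha hb
  have h2 := leviCivita_sub g ha hb
  rw [pullbackConn_push g h φ ha, pullbackConn_push g h φ hb, push_apply, ← h2, map_sub] at h1
  simp only [extend_apply_self] at h1
  rw [add_sub_add_comm, add_eq_right] at h1
  exact sub_eq_zero.1 h1

/-- The second fundamental form as a bilinear map. -/
def secondFundamentalFormₗ (x : M) :
    TangentSpace 𝓘(ℝ, E) x →ₗ[ℝ] TangentSpace 𝓘(ℝ, E) x →ₗ[ℝ] PullbackTangent φ x :=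
  -- Linearity in the first slot is that of the connections. In the second slot it would involve
  -- extensions of sums, which symmetry avoids.
  have add (a a' b : TangentSpace 𝓘(ℝ, E) x) : secondFundamentalForm g h φ x (a + a') b =
      secondFundamentalForm g h φ x a b + secondFundamentalForm g h φ x a' b := by
    simp only [secondFundamentalForm, map_add]
    abel
  have smul (c : ℝ) (a b : TangentSpace 𝓘(ℝ, E) x) : secondFundamentalForm g h φ x (c • a) b =
      c • secondFundamentalForm g h φ x a b := by
    simp only [secondFundamentalForm, map_smul, smul_sub]
  LinearMap.mk₂ ℝ (secondFundamentalForm g h φ x) add smul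
    (fun a b b' ↦ by simp only [secondFundamentalForm_symm g h φ a, add])
    (fun c a b ↦ by simp only [secondFundamentalForm_symm g h φ a, smul])

theorem secondFundamentalFormₗ_apply (a b : TangentSpace 𝓘(ℝ, E) x) :
    secondFundamentalFormₗ g h φ x a b = secondFundamentalForm g h φ x a b := rfl

theorem smoothSectionAt_secondFundamentalForm {X Y : Π x : M, TangentSpace 𝓘(ℝ, E) x}
    (hX : SmoothSectionAt E E X x) (hY : SmoothSectionAt E E Y x) :
    SmoothSectionAt E F (fun y ↦ secondFundamentalForm g h φ y (X y) (Y y)) x := by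
  have h1 : SmoothSectionAt E F (fun y ↦ pullbackConn h φ (push φ Y) y (X y) -
      push φ (fun y ↦ leviCivita g Y y (X y)) y) x :=
    (smoothSectionAt_pullbackConn h φ (smoothSectionAt_push φ hY) hX).sub_section
      (smoothSectionAt_push φ (contMDiffAt_leviCivita g hX hY))
  refine h1.congr ?_
  filter_upwards [eventually_mdifferentiableAt_section hY] with y hy
  exact secondFundamentalForm_eq g h φ hy _

theorem inner_sum_onb (w : TangentSpace 𝓘(ℝ, E) x) :
    ∑ j, g.inner x w (onb g x j) • onb g x j = w := by
  conv_rhs => rw [← (onb g x).sum_repr w]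
  refine Finset.sum_congr rfl fun j _ ↦ ?_
  congr 1
  conv_lhs => rw [← (onb g x).sum_repr w]
  simp only [map_sum, map_smul, sum_apply, smul_apply, onb_orthonormal, smul_eq_mul]
  simp

/-- Differentiability is part of the conclusion because the induction step needs it for the partial
sum. -/
theorem mvfderiv_sum_mul {ι : Type*} (s : Finset ι) {a b : ι → M → ℝ}
    (ha : ∀ i, MDiffAt (a i) x) (hb : ∀ i, MDiffAt (b i) x) (v : TangentSpace 𝓘(ℝ, E) x) :
    MDiffAt (fun y ↦ ∑ i ∈ s, a i y * b i y) x ∧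
      mvfderiv 𝓘(ℝ, E) (fun y ↦ ∑ i ∈ s, a i y * b i y) x v =
        ∑ i ∈ s, (a i x * mvfderiv 𝓘(ℝ, E) (b i) x v + b i x * mvfderiv 𝓘(ℝ, E) (a i) x v) := by
  classical
  induction s using Finset.induction_on with
  | empty =>
    simp only [Finset.sum_empty, mvfderiv_const]
    exact ⟨mdifferentiableAt_const, rfl⟩
  | insert k s hk ih =>
    simp only [Finset.sum_insert hk]
    have hm : MDiffAt (fun y ↦ a k y * b k y) x := (ha k).mul (hb k)
    refine ⟨hm.add ih.1, ?_⟩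
    refine (congrArg (fun L : TangentSpace 𝓘(ℝ, E) x →L[ℝ] ℝ ↦ L v)
      (mvfderiv_add hm ih.1)).trans ?_
    rw [add_apply, ih.2]
    refine congrArg (· + _) ?_
    refine (congrArg (fun L : TangentSpace 𝓘(ℝ, E) x →L[ℝ] ℝ ↦ L v)
      (mvfderiv_mul (ha k) (hb k))).trans ?_
    simp

/-- The covariant derivative of the tension field: the trace commutes with the derivative. -/
theorem pullbackConn_tension (v : TangentSpace 𝓘(ℝ, E) x) :
    pullbackConn h φ (tension g h φ) x v =
      ∑ i, (pullbackConn h φ (fun y ↦ secondFundamentalForm g h φ y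
          (extend E (onb g x i) y) (extend E (onb g x i) y)) x v
        - (2 : ℝ) • secondFundamentalForm g h φ x (leviCivita g (extend E (onb g x i)) x v)
            (onb g x i)) := by
  classical
  let t := trivializationAt E (TangentSpace 𝓘(ℝ, E)) x
  have hx : x ∈ t.baseSet := mem_baseSet_trivializationAt E (TangentSpace 𝓘(ℝ, E)) x
  -- The bases `onb g y` are chosen separately at each `y` and need not vary smoothly, so the trace
  -- is rewritten near `x` in the smooth frame `e`. The basis `b` of `E` consists of the components
  -- of `onb g x`, so its local frame is `e` by definition.
  let b := (onb g x).map (t.linearEquivAt (R := ℝ) x hx)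
  let e := fun i ↦ extend E (onb g x i)
  have he (i) : SmoothSectionAt E E (e i) x := smoothSectionAt_extend _
  have hex (i) : e i x = onb g x i := extend_apply_self ..
  have hb (y : M) (hy : y ∈ t.baseSet) : (fun i ↦ e i y) = t.basisAt b hy := by
    funext i
    rfl
  let G := fun y ↦ gram g y fun i ↦ e i y
  have hG (i j) : CMDiffAt ∞ (fun y ↦ G y i j) x := contMDiffAt_metric g (he i) (he j)
  have hGdet (y : M) (hy : y ∈ t.baseSet) : (G y).det ≠ 0 := by
    simp only [G, hb y hy]
    exact gram_det_ne_zero g _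
  have hH (i j) := contMDiffAt_matrix_inv hG (hGdet x hx) i j
  have hGd (i j) : MDiffAt (fun y ↦ G y i j) x := (hG i j).mdifferentiableAt (by simp)
  have hHd (i j) : MDiffAt (fun y ↦ (G y)⁻¹ i j) x := (hH i j).mdifferentiableAt (by simp)
  have hG1 : G x = 1 := by
    ext i j
    simp only [G, gram, Matrix.of_apply, hex, onb_orthonormal, Matrix.one_apply]
  -- Differentiating `G G⁻¹ = 1` at `x`, where `G x = 1`, gives `d(G⁻¹) = -dG`.
  have hdH (i j) : mvfderiv 𝓘(ℝ, E) (fun y ↦ (G y)⁻¹ i j) x v =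
      - mvfderiv 𝓘(ℝ, E) (fun y ↦ G y i j) x v := by
    have h1 : (fun y ↦ ∑ k, G y i k * (G y)⁻¹ k j) =ᶠ[nhds x]
        fun _ ↦ (1 : Matrix (Fin (Module.finrank ℝ E)) (Fin (Module.finrank ℝ E)) ℝ) i j := by
      filter_upwards [t.open_baseSet.mem_nhds hx] with y hy
      rw [← Matrix.mul_apply, Matrix.mul_nonsing_inv _ (hGdet y hy).isUnit]
    have h2 := congrArg (fun L : TangentSpace 𝓘(ℝ, E) x →L[ℝ] ℝ ↦ L v)
      (mvfderiv_congr (E := E) (F := ℝ) h1)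
    simp only [mvfderiv_const] at h2
    have h3 := (mvfderiv_sum_mul Finset.univ (fun k ↦ hGd i k) (fun k ↦ hHd k j) v).2.symm.trans h2
    simp only [hG1, inv_one, zero_apply, Finset.sum_add_distrib, Matrix.one_apply, ite_mul, one_mul,
      zero_mul, Finset.sum_ite_eq, Finset.sum_ite_eq', Finset.mem_univ, if_true] at h3
    exact eq_neg_of_add_eq_zero_left h3
  have hdG (i j) : mvfderiv 𝓘(ℝ, E) (fun y ↦ G y i j) x v =
      g.inner x (leviCivita g (e i) x v) (onb g x j)
        + g.inner x (leviCivita g (e j) x v) (onb g x i) := by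
    have := leviCivita_metric g (he i).diffSectionAt (he j).diffSectionAt v
    rw [hex, hex, g.symm x (onb g x i)] at this
    exact this
  have hs (i j) := (smoothSectionAt_secondFundamentalForm g h φ (he i) (he j)).diffSectionAt
  have hterm (p : Fin (Module.finrank ℝ E) × Fin (Module.finrank ℝ E)) :
      MDiffAt (fun y ↦ (G y)⁻¹ p.1 p.2) x := hHd p.1 p.2
  have hτ : ∀ᶠ y in nhds x, tension g h φ y =
      ∑ p : Fin (Module.finrank ℝ E) × Fin (Module.finrank ℝ E),
        (G y)⁻¹ p.1 p.2 • secondFundamentalForm g h φ y (e p.1 y) (e p.2 y) := by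
    filter_upwards [t.open_baseSet.mem_nhds hx] with y hy
    have := sum_onb_eq_sum_gram_inv g (t.basisAt b hy) (secondFundamentalFormₗ g h φ y)
    simp only [← hb y hy, secondFundamentalFormₗ_apply] at this
    rw [Fintype.sum_prod_type]
    exact this
  rw [conn_congr (pullbackConn h φ) (MDifferentiableAt.sum_section fun p _ ↦
    (hterm p).smul_section (hs p.1 p.2)) hτ]
  refine (conn_sum_smul (pullbackConn h φ) hterm (fun p ↦ hs p.1 p.2) v).trans ?_
  rw [Fintype.sum_prod_type]
  -- Each of the two terms of `dG` from metric compatibility contracts with the form to `B(∇_v e_i,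
  -- e_i)`, which accounts for the factor 2. The second does so after exchanging the summation
  -- indices and using symmetry.
  have hB1 (i) : ∑ j, g.inner x (leviCivita g (e i) x v) (onb g x j) •
      secondFundamentalForm g h φ x (onb g x i) (onb g x j) =
      secondFundamentalForm g h φ x (leviCivita g (e i) x v) (onb g x i) := by
    rw [secondFundamentalForm_symm g h φ (leviCivita g (e i) x v)]
    simp only [← secondFundamentalFormₗ_apply]
    conv_rhs => rw [← inner_sum_onb g (leviCivita g (e i) x v)]
    simp only [map_sum, map_smul]
  have hB2 (i) : ∑ j, g.inner x (leviCivita g (e j) x v) (onb g x i) •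
      secondFundamentalForm g h φ x (onb g x i) (onb g x j) =
      ∑ j, g.inner x (leviCivita g (e j) x v) (onb g x i) •
      secondFundamentalForm g h φ x (onb g x j) (onb g x i) :=
    Finset.sum_congr rfl fun j _ ↦ by rw [secondFundamentalForm_symm]
  simp only [hdH, hdG, hG1, inv_one, hex, Matrix.one_apply, ite_smul, one_smul, zero_smul,
    Finset.sum_add_distrib, Finset.sum_ite_eq, Finset.mem_univ, if_true, neg_add, add_smul,
    neg_smul, Finset.sum_neg_distrib, hB1, hB2, Finset.sum_sub_distrib]
  rw [Finset.sum_comm (f := fun i j ↦ g.inner x (leviCivita g (e j) x v) (onb g x i) •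
      secondFundamentalForm g h φ x (onb g x j) (onb g x i))]
  simp only [hB1, two_smul, Finset.sum_add_distrib]
  abel

end SecondFundamentalForm

/-! ### The curvature tensor evaluated on arbitrary smooth fields. -/

section Curvature

variable {E : Type*} [NormedAddCommGroup E] [NormedSpace ℝ E] [FiniteDimensional ℝ E]
  {M : Type*} [TopologicalSpace M] [ChartedSpace E M] [IsManifold 𝓘(ℝ, E) ∞ M]
  (g : ContMDiffRiemannianMetric 𝓘(ℝ, E) ∞ E (fun x : M ↦ TangentSpace 𝓘(ℝ, E) x)) {x : M}

/-- Independence of the extensions needs no separate tensoriality argument: it is the pull-back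
curvature identity `curvatureAlong_eq` for the identity map, along which `∇^φ` is `∇`. -/
theorem curvature_eq {X Y Z : Π x : M, TangentSpace 𝓘(ℝ, E) x} (hX : SmoothSectionAt E E X x)
    (hY : SmoothSectionAt E E Y x) (hZ : SmoothSectionAt E E Z x) :
    curvature g x (X x) (Y x) (Z x) =
      leviCivita g (fun y ↦ leviCivita g Z y (Y y)) x (X x)
        - leviCivita g (fun y ↦ leviCivita g Z y (X y)) x (Y x)
        - leviCivita g Z x (VectorField.mlieBracket 𝓘(ℝ, E) X Y x) := by
  let I : C^∞⟮𝓘(ℝ, E), M; 𝓘(ℝ, E), M⟯ := ContMDiffMap.id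
  have hI (y : M) (a : TangentSpace 𝓘(ℝ, E) y) : differential I y a = a := by
    change mfderiv 𝓘(ℝ, E) 𝓘(ℝ, E) id y a = a
    rw [mfderiv_id]
    rfl
  have h1 {W : Π x : M, TangentSpace 𝓘(ℝ, E) x} {y : M} (hW : DiffSectionAt E E W y)
      (a : TangentSpace 𝓘(ℝ, E) y) :
      pullbackConn g I (pullSection I W) y a = leviCivita g W y a := by
    rw [pullbackConn_pullSection g I (x := y) hW, hI]
    rfl
  have h2 {X : Π x : M, TangentSpace 𝓘(ℝ, E) x} (hX : SmoothSectionAt E E X x)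
      (a : TangentSpace 𝓘(ℝ, E) x) :
      pullbackConn g I (fun z ↦ pullbackConn g I (pullSection I Z) z (X z)) x a =
        leviCivita g (fun y ↦ leviCivita g Z y (X y)) x a := by
    have hZX : SmoothSectionAt E E (fun y ↦ leviCivita g Z y (X y)) (I x) :=
      contMDiffAt_leviCivita g hX hZ
    rw [conn_congr (pullbackConn g I)
      (σ := pullSection I (fun y ↦ leviCivita g Z y (X y)))
      (smoothSectionAt_pullSection I hZX).diffSectionAt]
    · exact h1 hZX.diffSectionAt a
    · filter_upwards [eventually_mdifferentiableAt_section hZ] with y hy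
      exact h1 hy _
  have key := curvatureAlong_eq g I (x := x) (smoothSectionAt_pullSection I (x := x) hZ) hX hY
  rw [curvatureAlong, h2 hX, h2 hY, h1 hZ.diffSectionAt] at key
  rw [push_apply, push_apply, hI, hI] at key
  exact key.symm

end Curvature

/-! ### The commutation formula along one vector field. -/

section Commutation

variable {E : Type*} [NormedAddCommGroup E] [NormedSpace ℝ E] [FiniteDimensional ℝ E]
  {M : Type*} [TopologicalSpace M] [ChartedSpace E M] [IsManifold 𝓘(ℝ, E) ∞ M]
  (g : ContMDiffRiemannianMetric 𝓘(ℝ, E) ∞ E (fun x : M ↦ TangentSpace 𝓘(ℝ, E) x))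
  {F : Type*} [NormedAddCommGroup F] [NormedSpace ℝ F] [FiniteDimensional ℝ F]
  {N : Type*} [TopologicalSpace N] [ChartedSpace F N] [IsManifold 𝓘(ℝ, F) ∞ N]
  (h : ContMDiffRiemannianMetric 𝓘(ℝ, F) ∞ F (fun y : N ↦ TangentSpace 𝓘(ℝ, F) y))
  (φ : C^∞⟮𝓘(ℝ, E), M; 𝓘(ℝ, F), N⟯) {x : M}

/-- The second covariant derivative of `V` along `X`, corrected by the curvature term. -/
theorem leviCivita_leviCivita_add_curvature {X V : Π x : M, TangentSpace 𝓘(ℝ, E) x}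
    (hX : SmoothSectionAt E E X x) (hV : SmoothSectionAt E E V x) :
    leviCivita g (fun y ↦ leviCivita g V y (X y)) x (X x) + curvature g x (V x) (X x) (X x) =
      leviCivita g (VectorField.mlieBracket 𝓘(ℝ, E) X V) x (X x)
        + leviCivita g (fun y ↦ leviCivita g X y (X y)) x (V x)
        + leviCivita g X x (VectorField.mlieBracket 𝓘(ℝ, E) X V x) := by
  have hXV : SmoothSectionAt E E (VectorField.mlieBracket 𝓘(ℝ, E) X V) x :=
    contMDiffAt_mlieBracket hX hV
  have hVX : SmoothSectionAt E E (fun y ↦ leviCivita g X y (V y)) x :=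
    contMDiffAt_leviCivita g hV hX
  -- Torsion-freeness replaces `∇_X V` by `∇_V X + [X,V]`. The curvature `R(V,X)X` then exchanges
  -- `∇_X ∇_V X` for `∇_V ∇_X X`, and its bracket term contributes `∇_{[X,V]} X`.
  have h1 : ∀ᶠ y in nhds x, leviCivita g V y (X y) =
      leviCivita g X y (V y) + VectorField.mlieBracket 𝓘(ℝ, E) X V y := by
    filter_upwards [eventually_mdifferentiableAt_section hX,
      eventually_mdifferentiableAt_section hV] with y h1 h2
    rw [← leviCivita_sub g h1 h2, add_sub_cancel]
  have h2 : leviCivita g (fun y ↦ leviCivita g V y (X y)) x (X x) =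
      leviCivita g (fun y ↦ leviCivita g X y (V y)) x (X x) +
        leviCivita g (VectorField.mlieBracket 𝓘(ℝ, E) X V) x (X x) := by
    rw [conn_congr (leviCivita g)
      (mdifferentiableAt_add_section hVX.diffSectionAt hXV.diffSectionAt) h1]
    exact conn_add (leviCivita g) hVX.diffSectionAt hXV.diffSectionAt _
  rw [curvature_eq g hV hX hX, h2, VectorField.mlieBracket_swap_apply (V := V), map_neg]
  abel

/-- The second covariant derivative of `dφ(V)` along `X`, corrected by the curvature term. -/
theorem pullbackConn_pullbackConn_push_add_curvature {X V : Π x : M, TangentSpace 𝓘(ℝ, E) x}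
    (hX : SmoothSectionAt E E X x) (hV : SmoothSectionAt E E V x) :
    pullbackConn h φ (fun y ↦ pullbackConn h φ (push φ V) y (X y)) x (X x)
        + pullbackCurvature h φ x (push φ V x) (push φ X x) (push φ X x) =
      pullbackConn h φ (push φ (VectorField.mlieBracket 𝓘(ℝ, E) X V)) x (X x)
        + pullbackConn h φ (fun y ↦ pullbackConn h φ (push φ X) y (X y)) x (V x)
        + pullbackConn h φ (push φ X) x (VectorField.mlieBracket 𝓘(ℝ, E) X V x) := by
  have hpX := smoothSectionAt_push φ hX
  have hXV := (smoothSectionAt_push φ (contMDiffAt_mlieBracket hX hV)).diffSectionAt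
  have hVX := (smoothSectionAt_pullbackConn h φ hpX hV).diffSectionAt
  have h1 : ∀ᶠ y in nhds x, pullbackConn h φ (push φ V) y (X y) =
      pullbackConn h φ (push φ X) y (V y) + push φ (VectorField.mlieBracket 𝓘(ℝ, E) X V) y := by
    filter_upwards [eventually_mdifferentiableAt_section hX,
      eventually_mdifferentiableAt_section hV] with y h1 h2
    rw [← pullbackConn_push_sub h φ h1 h2, add_sub_cancel]
  rw [← curvatureAlong_eq h φ hpX hV hX, curvatureAlong,
    conn_congr (pullbackConn h φ) (mdifferentiableAt_add_section hVX hXV) h1,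
    VectorField.mlieBracket_swap_apply (V := V), map_neg]
  refine (congrArg (· + _) (conn_add (pullbackConn h φ) hVX hXV _)).trans ?_
  abel

/-- Splitting `∇^φ_X dφ(X)` near `x` into `B(X,X)` and `dφ(∇_X X)` isolates the derivative of the
second fundamental form, from which the derivative of the tension field arises. -/
theorem pullbackConn_pullbackConn_push_self {X : Π x : M, TangentSpace 𝓘(ℝ, E) x}
    (hX : SmoothSectionAt E E X x) (v : TangentSpace 𝓘(ℝ, E) x) :
    pullbackConn h φ (fun y ↦ pullbackConn h φ (push φ X) y (X y)) x v =
      pullbackConn h φ (fun y ↦ secondFundamentalForm g h φ y (X y) (X y)) x v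
        + (secondFundamentalForm g h φ x v (leviCivita g X x (X x))
        + differential φ x (leviCivita g (fun y ↦ leviCivita g X y (X y)) x v)) := by
  have hXX : SmoothSectionAt E E (fun y ↦ leviCivita g X y (X y)) x :=
    contMDiffAt_leviCivita g hX hX
  have hs := (smoothSectionAt_secondFundamentalForm g h φ hX hX).diffSectionAt
  have hp := (smoothSectionAt_push φ hXX).diffSectionAt
  have h1 : ∀ᶠ y in nhds x, pullbackConn h φ (push φ X) y (X y) =
      secondFundamentalForm g h φ y (X y) (X y) + push φ (fun y ↦ leviCivita g X y (X y)) y := by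
    filter_upwards [eventually_mdifferentiableAt_section hX] with y hy
    exact pullbackConn_push g h φ hy _
  rw [conn_congr (pullbackConn h φ) (mdifferentiableAt_add_section hs hp) h1,
    ← pullbackConn_push g h φ hXX.diffSectionAt]
  exact conn_add (pullbackConn h φ) hs hp v

/-- The commutation formula along a single vector field `X`, before taking traces. -/
theorem commutation_along {X V : Π x : M, TangentSpace 𝓘(ℝ, E) x}
    (hX : SmoothSectionAt E E X x) (hV : SmoothSectionAt E E V x) :
    pullbackConn h φ (fun y ↦ pullbackConn h φ (push φ V) y (X y)) x (X x)
        - pullbackConn h φ (push φ V) x (leviCivita g X x (X x))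
        + pullbackCurvature h φ x (push φ V x) (push φ X x) (push φ X x) =
      differential φ x (leviCivita g (fun y ↦ leviCivita g V y (X y)) x (X x)
        - leviCivita g V x (leviCivita g X x (X x)) + curvature g x (V x) (X x) (X x))
      + (pullbackConn h φ (fun y ↦ secondFundamentalForm g h φ y (X y) (X y)) x (V x)
        - (2 : ℝ) • secondFundamentalForm g h φ x (leviCivita g X x (V x)) (X x))
      + (2 : ℝ) • secondFundamentalForm g h φ x (X x) (leviCivita g V x (X x)) := by
  have hXV : SmoothSectionAt E E (VectorField.mlieBracket 𝓘(ℝ, E) X V) x :=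
    contMDiffAt_mlieBracket hX hV
  rw [sub_add_eq_add_sub, pullbackConn_pullbackConn_push_add_curvature h φ hX hV, sub_add_eq_add_sub,
    leviCivita_leviCivita_add_curvature g hX hV, pullbackConn_pullbackConn_push_self g h φ hX,
    pullbackConn_push g h φ hXV.diffSectionAt, pullbackConn_push g h φ hX.diffSectionAt,
    pullbackConn_push g h φ hV.diffSectionAt,
    secondFundamentalForm_symm g h φ (leviCivita g X x (X x)),
    secondFundamentalForm_symm g h φ (VectorField.mlieBracket 𝓘(ℝ, E) X V x),
    secondFundamentalForm_symm g h φ (leviCivita g X x (V x))]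
  -- The term `B(X, [X,V])` occurs twice, from `∇^φ_X dφ([X,V])` and from `∇^φ_{[X,V]} dφ(X)`; this
  -- gives both factors 2. The term `B(V, ∇_X X)` cancels against the one from `∇^φ_{∇_X X} dφ(V)`.
  have hb : secondFundamentalForm g h φ x (X x) (VectorField.mlieBracket 𝓘(ℝ, E) X V x) =
      secondFundamentalForm g h φ x (X x) (leviCivita g V x (X x)) -
      secondFundamentalForm g h φ x (X x) (leviCivita g X x (V x)) := by
    rw [← leviCivita_sub g hX.diffSectionAt hV.diffSectionAt]
    simp only [← secondFundamentalFormₗ_apply, map_sub]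
  rw [hb]
  simp only [map_add, map_sub]
  module

end Commutation

end RiemMap

end

/-! ### Taking the trace. -/

theorem proposition1
    {E : Type*} [NormedAddCommGroup E] [NormedSpace ℝ E] [FiniteDimensional ℝ E]
    {M : Type*} [TopologicalSpace M] [ChartedSpace E M] [IsManifold 𝓘(ℝ, E) ∞ M]
    (g : ContMDiffRiemannianMetric 𝓘(ℝ, E) ∞ E (fun x : M ↦ TangentSpace 𝓘(ℝ, E) x))
    {F : Type*} [NormedAddCommGroup F] [NormedSpace ℝ F] [FiniteDimensional ℝ F]
    {N : Type*} [TopologicalSpace N] [ChartedSpace F N] [IsManifold 𝓘(ℝ, F) ∞ N]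
    (h : ContMDiffRiemannianMetric 𝓘(ℝ, F) ∞ F (fun y : N ↦ TangentSpace 𝓘(ℝ, F) y))
    (φ : C^∞⟮𝓘(ℝ, E), M; 𝓘(ℝ, F), N⟯)
    (V : Π x : M, TangentSpace 𝓘(ℝ, E) x)
    (hV : ContMDiff 𝓘(ℝ, E) 𝓘(ℝ, E).tangent ∞
      (fun x ↦ (⟨x, V x⟩ : TangentBundle 𝓘(ℝ, E) M)))
    (x : M) :
    RiemMap.roughLaplacian g (RiemMap.pullbackConn h φ) (RiemMap.push φ V) x
        + RiemMap.ricciAlong g h φ x (RiemMap.differential φ x (V x)) =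
      RiemMap.differential φ x
          (RiemMap.roughLaplacian g (RiemMap.leviCivita g) V x + RiemMap.ricci g x (V x))
        + RiemMap.pullbackConn h φ (RiemMap.tension g h φ) x (V x)
        + (2 : ℝ) • ∑ i, RiemMap.secondFundamentalForm g h φ x (RiemMap.onb g x i)
            (RiemMap.leviCivita g V x (RiemMap.onb g x i)) := by
  rw [RiemMap.pullbackConn_tension, Finset.smul_sum, RiemMap.roughLaplacian, RiemMap.roughLaplacian,
    RiemMap.ricci, ← Finset.sum_add_distrib, map_sum, ← Finset.sum_add_distrib,
    ← Finset.sum_add_distrib]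
  -- All terms are now sums over the same basis at `x`, and each summand is the formula along the
  -- extension of `e_i`. The terms `-2B(∇_V e_i, e_i)` in it are those produced by
  -- `pullbackConn_tension`.
  refine (Finset.sum_add_distrib ..).symm.trans (Finset.sum_congr rfl fun i _ ↦ ?_)
  have := RiemMap.commutation_along g h φ (RiemMap.smoothSectionAt_extend (RiemMap.onb g x i))
    hV.contMDiffAt
  simp only [RiemMap.push_apply, extend_apply_self] at this ⊢
  exact this
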